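/- Let $V$ be a finite-dimensional complex vector space and let $W < GL(V)$ be a reflection group of type $G_{30} = H_4$ in its reflection representation; that is, $V$ has a basis $b_1,\dots,b_4$ such that $W$ is generated by the reflections $s_i(b_j) = b_j + 2\cos(\pi/m_{ij})\, b_i$, where $(m_{ij})$ is the Coxeter matrix of type $H_4$. Let $R(W)$ be the representation ring of $W$, that is, the Grothendieck ring of the finite-dimensional complex representations of $W$, with sum induced by $\oplus$ and product induced by $\otimes$. For a partition $\lambda$, let $\mathcal{S}_\lambda(V)$ be the representation of $W$ obtained by applying to $V$ the Schur functor of $\lambda$ (so that $\mathcal{S}_{[1^r]}(V) = \Lambda^r V$). Then the ring $R(W)$ is generated by the classes of the one-dimensional representations of $W$ and of the representations $\mathcal{S}_\lambda(V)$ for all partitions $\lambda$ with $|\lambda| \le 8$. -/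

import Mathlib

open CategoryTheory

noncomputable section

/-! ### The representation ring -/

namespace RepRing

/-- The additivity relations `[A ⊕ B] - [A] - [B]`, written in the ring `ℤ[M]`, where `M` is the
monoid of isomorphism classes of finite-dimensional complex representations of `G` under `⊗`. -/
def relations (G : Type) [Group G] : Set (MonoidAlgebra ℤ (Skeleton (FDRep ℂ G))) :=
  {x | ∃ A B : FDRep ℂ G,
    x = MonoidAlgebra.of ℤ _ (toSkeleton (FDRep.of (Representation.prod A.ρ B.ρ)))
      - MonoidAlgebra.of ℤ _ (toSkeleton A) - MonoidAlgebra.of ℤ _ (toSkeleton B)}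

end RepRing

/-- The representation ring `R(G)`: the Grothendieck ring of finite-dimensional complex
representations of `G`, with addition induced by `⊕` and multiplication induced by `⊗`. -/
abbrev RepRing (G : Type) [Group G] : Type 1 :=
  MonoidAlgebra ℤ (Skeleton (FDRep ℂ G)) ⧸ Ideal.span (RepRing.relations G)

/-- The class of a finite-dimensional complex representation in the representation ring. -/
def RepRing.mk {G : Type} [Group G] (A : FDRep ℂ G) : RepRing G :=
  Ideal.Quotient.mk (Ideal.span (RepRing.relations G)) (MonoidAlgebra.of ℤ _ (toSkeleton A))

/-! ### Schur functors -/

section Schur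

open scoped TensorProduct

variable {G V : Type} [Group G] [AddCommGroup V] [Module ℂ V]

/-- The tensor power of `V` whose factors are indexed by the cells of the Young diagram `μ`. -/
abbrev CellTensor (μ : YoungDiagram) (V : Type) [AddCommGroup V] [Module ℂ V] : Type :=
  ⨂[ℂ] _ : μ.cells, V

/-- The place permutation of tensor factors. -/
def permTensor (μ : YoungDiagram) (V : Type) [AddCommGroup V] [Module ℂ V]
    (p : Equiv.Perm μ.cells) : CellTensor μ V →ₗ[ℂ] CellTensor μ V :=
  (PiTensorProduct.reindex ℂ (fun _ : μ.cells => V) p).toLinearMap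

/-- The action on `CellTensor μ V` of the Young symmetrizer of `μ`: the sum of
`sign q • (p ∘ q)` over the permutations `p` of the cells that preserve every row and the
permutations `q` of the cells that preserve every column. -/
def youngSymmetrizer (μ : YoungDiagram) (V : Type) [AddCommGroup V] [Module ℂ V] :
    CellTensor μ V →ₗ[ℂ] CellTensor μ V :=
  ∑ p : Equiv.Perm μ.cells with (∀ c, (p c).1.1 = c.1.1),
    ∑ q : Equiv.Perm μ.cells with (∀ c, (q c).1.2 = c.1.2),
      (Equiv.Perm.sign q : ℤ) • (permTensor μ V p ∘ₗ permTensor μ V q)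

/-- The diagonal action of `G` on the tensor power of a representation. -/
def cellTensorRep (μ : YoungDiagram) (ρ : Representation ℂ G V) :
    Representation ℂ G (CellTensor μ V) where
  toFun g := PiTensorProduct.map fun _ => ρ g
  map_one' := by simp only [map_one]; exact PiTensorProduct.map_one
  map_mul' g h := by simp only [map_mul]; exact PiTensorProduct.map_mul _ _

lemma cellTensorRep_permTensor (μ : YoungDiagram) (ρ : Representation ℂ G V) (g : G)
    (p : Equiv.Perm μ.cells) (x : CellTensor μ V) :
    cellTensorRep μ ρ g (permTensor μ V p x) = permTensor μ V p (cellTensorRep μ ρ g x) :=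
  PiTensorProduct.map_reindex (fun _ : μ.cells => ρ g) p x

lemma cellTensorRep_youngSymmetrizer (μ : YoungDiagram) (ρ : Representation ℂ G V) (g : G)
    (x : CellTensor μ V) :
    cellTensorRep μ ρ g (youngSymmetrizer μ V x)
      = youngSymmetrizer μ V (cellTensorRep μ ρ g x) := by
  have hperm (p : Equiv.Perm μ.cells) :
      Commute (cellTensorRep μ ρ g : Module.End ℂ (CellTensor μ V)) (permTensor μ V p) :=
    LinearMap.ext fun y => cellTensorRep_permTensor μ ρ g p y
  have h : Commute (cellTensorRep μ ρ g : Module.End ℂ (CellTensor μ V))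
      (youngSymmetrizer μ V) :=
    Commute.sum_right _ _ _ fun p _ => Commute.sum_right _ _ _ fun q _ =>
      ((hperm p).mul_right (hperm q)).smul_right (Equiv.Perm.sign q : ℤ)
  exact LinearMap.congr_fun h.eq x

/-- The Schur functor `S_μ` applied to a representation, as the subrepresentation of the tensor
power that is the image of the Young symmetrizer. One-row diagrams give symmetric powers and
one-column diagrams give exterior powers. -/
def schurSubrep (μ : YoungDiagram) (ρ : Representation ℂ G V) :
    Subrepresentation (cellTensorRep μ ρ) where
  toSubmodule := LinearMap.range (youngSymmetrizer μ V)
  apply_mem_toSubmodule := by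
    rintro g _ ⟨x, rfl⟩
    exact ⟨_, (cellTensorRep_youngSymmetrizer μ ρ g x).symm⟩

instance cellTensor_finite (μ : YoungDiagram) (V : Type) [AddCommGroup V] [Module ℂ V]
    [FiniteDimensional ℂ V] : FiniteDimensional ℂ (CellTensor μ V) :=
  Module.Finite.of_basis
    (Basis.piTensorProduct fun _ : μ.cells => Module.finBasis ℂ V)

/-- The representation `S_μ(V)`. -/
def schurFunctor [FiniteDimensional ℂ V] (μ : YoungDiagram) (ρ : Representation ℂ G V) :
    FDRep ℂ G :=
  FDRep.of (V := (schurSubrep μ ρ).toSubmodule) (schurSubrep μ ρ).toRepresentation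

end Schur

/-! ### Reflection groups -/

section Reflection

variable {ι : Type} {V : Type} [AddCommGroup V] [Module ℂ V]

/-- The linear form `2 B(b i, ·)`, where `B` is the symmetric bilinear form with
`B (b i) (b j) = - cos (π / M i j)`. -/
def simpleCoroot (M : CoxeterMatrix ι) (b : Module.Basis ι ℂ V) (i : ι) : Module.Dual ℂ V :=
  b.constr ℂ fun j => ((-2 * Real.cos (Real.pi / M i j) : ℝ) : ℂ)

lemma simpleCoroot_self (M : CoxeterMatrix ι) (b : Module.Basis ι ℂ V) (i : ι) :
    simpleCoroot M b i (b i) = 2 := by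
  simp [simpleCoroot]

/-- The simple reflection `v ↦ v - 2 B(b i, v) b i` of the geometric representation. -/
def simpleReflection (M : CoxeterMatrix ι) (b : Module.Basis ι ℂ V) (i : ι) : V ≃ₗ[ℂ] V :=
  Module.reflection (simpleCoroot_self M b i)

/-- A subgroup `W` of `GL(V)` is a reflection group of Coxeter type `M` if, for a suitable basis of
simple roots of `V`, it is the image of the (complexified) geometric representation of the Coxeter
group of `M`. -/
def IsReflectionGroupOfType (M : CoxeterMatrix ι) (W : Subgroup (V ≃ₗ[ℂ] V)) : Prop :=
  ∃ b : Module.Basis ι ℂ V, W = Subgroup.closure (Set.range (simpleReflection M b))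

/-- The tautological representation on `V` of a subgroup of `GL(V)`. -/
def reflectionRep (W : Subgroup (V ≃ₗ[ℂ] V)) : Representation ℂ W V :=
  (LinearEquiv.automorphismGroup.toLinearMapMonoidHom (R := ℂ) (M := V)).comp W.subtype

end Reflection

end

/-! Identify `V` with the complexified quaternions so that the simple roots become unit icosians,
one of them being 1. The reflection in a unit r is x ↦ -r x̄ r, and W turns out to consist of all
maps x ↦ a x b̄ and x ↦ a x̄ b̄ with a, b in the binary icosahedral group I of order 120. So W is a
quotient of I × I in which (-1, -1) dies, extended by the conjugation C, which swaps the two factors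
(`closure_simpleReflection`, `rot_mem_reflectionSubgroup`).

Let t be the trace of the two-dimensional representation of I. For functions P, Q of t, let T(P) be
the class function with value P(a)P(b) on the rotation (a, b) and P(ab) on (a, b)C, and let Ind(P,
Q) have value P(a)Q(b) + Q(a)P(b) on (a, b) and 0 on (a, b)C. Then det ⊗ V has character T(t) and
Λ²V has character Ind(t² - 1, 1). The identities T(P)T(Q) = T(PQ), T(P) Ind(Q, R) = Ind(PQ, PR),
Ind(P, 1) Ind(Q, 1) = Ind(PQ, 1) + Ind(P, Q), T(P + Q) = T(P) + T(Q) + Ind(P, Q) and det · T(P) =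
T(-P) then realise, in the subring generated by det, V and Λ²V, every T(P) and every Ind(P, Q) with
P, Q integral polynomials in t of the same parity (`exists_isTensorSquare`, `exists_isInduced`). The
irreducible characters of I are such polynomials.

The irreducible representations of W need not be classified. An element of norm one in R(W) is ± an
irreducible class, and the norm-one elements found above have an integral combination whose
character vanishes off the identity only. Hence every irreducible class pairs nontrivially with one
of them, and so lies in the subring (`RepRing.subring_eq_top`). -/

noncomputable section

/-! ### The representation ring, its irreducible classes and the character pairing -/

namespace RepRing

variable {G : Type} [Group G]

lemma mk_eq_mk_of_iso {A B : FDRep ℂ G} (h : Nonempty (A ≅ B)) : mk A = mk B := by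
  have hs : (toSkeleton A : Skeleton (FDRep ℂ G)) = toSkeleton B := Quotient.sound h
  unfold mk
  rw [hs]

lemma mk_prod (A B : FDRep ℂ G) :
    mk (FDRep.of (Representation.prod A.ρ B.ρ)) = mk A + mk B := by
  unfold mk
  rw [← map_add, Ideal.Quotient.eq]
  exact Ideal.subset_span ⟨A, B, by ring⟩

lemma character_prod (A B : FDRep ℂ G) :
    (FDRep.of (Representation.prod A.ρ B.ρ)).character = A.character + B.character := by
  ext g
  exact LinearMap.trace_prodMap' (A.ρ g) (B.ρ g)

lemma character_out (A : FDRep ℂ G) :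
    FDRep.character (Quotient.out (toSkeleton A)) = A.character :=
  FDRep.char_iso (Classical.choice (Quotient.mk_out (s := isIsomorphicSetoid _) A))

/-- The character, as a multiplicative map on isomorphism classes. -/
def skeletonCharacter (G : Type) [Group G] : Skeleton (FDRep ℂ G) →* (G → ℂ) where
  toFun X := FDRep.character X.out
  map_one' := by
    rw [Skeleton.one_eq, character_out]
    ext g
    exact (LinearMap.trace_one ℂ ℂ).trans (by simp)
  map_mul' X Y := by
    rw [Skeleton.mul_eq, character_out, FDRep.char_tensor]

/-- The character homomorphism from the representation ring to the ring of functions. -/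
def charHom (G : Type) [Group G] : RepRing G →+* (G → ℂ) :=
  Ideal.Quotient.lift _ (MonoidAlgebra.lift ℤ _ _ (skeletonCharacter G)).toRingHom (by
    intro a ha
    refine (Ideal.span_le (I := RingHom.ker _)).2 ?_ ha
    rintro _ ⟨A, B, rfl⟩
    simp only [SetLike.mem_coe, RingHom.mem_ker, map_sub]
    simp [skeletonCharacter, character_out, character_prod])

lemma charHom_mk (A : FDRep ℂ G) : charHom G (mk A) = A.character := by
  simp [charHom, mk, skeletonCharacter, character_out]

/-- Equivalent representations are isomorphic objects. -/
lemma nonempty_iso_of_equiv {A B : FDRep ℂ G} (e : Representation.Equiv A.ρ B.ρ) :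
    Nonempty (A ≅ B) := by
  refine ⟨Action.mkIso (LinearEquiv.toFGModuleCatIso e.toLinearEquiv) fun g => ?_⟩
  ext x
  exact congrArg (fun f => f x) (e.toIntertwiningMap.isIntertwining' g)

lemma mk_eq_add_of_isCompl (A : FDRep ℂ G) (p q : Subrepresentation A.ρ) (h : IsCompl p q) :
    mk A = mk (FDRep.of (V := p.toSubmodule) p.toRepresentation)
      + mk (FDRep.of (V := q.toSubmodule) q.toRepresentation) := by
  have hpq : IsCompl p.toSubmodule q.toSubmodule := by
    refine ⟨disjoint_iff.2 ?_, codisjoint_iff.2 ?_⟩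
    · exact congrArg Subrepresentation.toSubmodule (disjoint_iff.1 h.1)
    · exact congrArg Subrepresentation.toSubmodule (codisjoint_iff.1 h.2)
  rw [← mk_prod]
  refine (mk_eq_mk_of_iso (nonempty_iso_of_equiv (Representation.Equiv.mk
    (Submodule.prodEquivOfIsCompl _ _ hpq) fun g => ?_))).symm
  ext x
  · simp [Subrepresentation.toRepresentation]
  · simp [Subrepresentation.toRepresentation]

/-- Isomorphism classes of irreducible representations. -/
def irr (G : Type) [Group G] : Set (Skeleton (FDRep ℂ G)) :=
  {X | Representation.IsIrreducible X.out.ρ}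

lemma mk_out (X : Skeleton (FDRep ℂ G)) :
    mk X.out = Ideal.Quotient.mk _ (MonoidAlgebra.of ℤ _ X) := by
  unfold mk
  congr 2
  exact Quotient.out_eq X

/-- The class of an isomorphism class of representations. -/
def cls (X : Skeleton (FDRep ℂ G)) : RepRing G := mk X.out

lemma cls_toSkeleton (A : FDRep ℂ G) : cls (toSkeleton A) = mk A :=
  mk_eq_mk_of_iso (Quotient.mk_out (s := isIsomorphicSetoid _) A)

/-- Since A ⊕ A ≅ A, additivity gives [A] = 2[A]. -/
lemma mk_eq_zero_of_subsingleton (A : FDRep ℂ G) (h : Subsingleton A) : mk A = 0 := by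
  have e : Representation.Equiv (FDRep.of (Representation.prod A.ρ A.ρ)).ρ A.ρ :=
    Representation.Equiv.mk
      ⟨LinearMap.fst ℂ A A, fun x => (x, x), fun x => Subsingleton.elim (α := A × A) _ _,
        fun x => Subsingleton.elim _ _⟩ fun g => LinearMap.ext fun x => Subsingleton.elim _ _
  have h2 := mk_prod A A
  rw [mk_eq_mk_of_iso (nonempty_iso_of_equiv e)] at h2
  simpa using h2

lemma isIrreducible_of_iso {A B : FDRep ℂ G} (i : A ≅ B) (h : Representation.IsIrreducible A.ρ) :
    Representation.IsIrreducible B.ρ := by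
  let e := FDRep.isoToLinearEquiv i
  have he (g : G) (x : A) : e (A.ρ g x) = B.ρ g (e x) := by
    rw [FDRep.Iso.conj_ρ i g]
    simp [e, LinearEquiv.conj_apply]
  let o : Subrepresentation B.ρ ≃o Subrepresentation A.ρ :=
    { toFun p := ⟨p.toSubmodule.comap e.toLinearMap, fun g v hv => by
        simp only [Submodule.mem_comap, LinearEquiv.coe_coe, he] at hv ⊢
        exact p.apply_mem_toSubmodule g hv⟩
      invFun p := ⟨p.toSubmodule.comap e.symm.toLinearMap, fun g v hv => by
        simp only [Submodule.mem_comap, LinearEquiv.coe_coe] at hv ⊢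
        have := p.apply_mem_toSubmodule g hv
        rwa [← e.symm_apply_apply (A.ρ g _), he, e.apply_symm_apply] at this⟩
      left_inv p := Subrepresentation.toSubmodule_injective (by ext; simp)
      right_inv p := Subrepresentation.toSubmodule_injective (by ext; simp)
      map_rel_iff' := by
        intro p q
        constructor
        · intro hpq x hx
          have := @hpq (e.symm x) (by change e (e.symm x) ∈ p; simpa using hx)
          change e (e.symm x) ∈ q at this
          simpa using this
        · intro hpq x hx
          exact hpq hx }
  exact (OrderIso.isSimpleOrder_iff o).2 h

variable [Finite G]

/-- Complete reducibility, by strong induction on the dimension. -/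
lemma mk_mem_closure_irr (A : FDRep ℂ G) :
    mk A ∈ Submodule.span ℤ (cls '' irr G) := by
  induction hn : Module.finrank ℂ A using Nat.strong_induction_on generalizing A with
  | _ n ih =>
  by_cases hs : Subsingleton A
  · rw [mk_eq_zero_of_subsingleton A hs]
    exact zero_mem _
  by_cases hA : Representation.IsIrreducible A.ρ
  · refine Submodule.subset_span ⟨toSkeleton A, ?_, cls_toSkeleton A⟩
    exact isIrreducible_of_iso
      (Classical.choice (Quotient.mk_out (s := isIsomorphicSetoid _) A)).symm hA
  · have hnt : Nontrivial A := not_subsingleton_iff_nontrivial.1 hs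
    have : ∃ p : Subrepresentation A.ρ, p ≠ ⊥ ∧ p ≠ ⊤ := by
      by_contra! hc
      have : Nontrivial (Subrepresentation A.ρ) := by
        refine ⟨⊥, ⊤, fun h => ?_⟩
        obtain ⟨x, hx⟩ := exists_ne (0 : A)
        have h2 : (x : A) ∈ (⊥ : Submodule ℂ A) := by
          rw [show (⊥ : Submodule ℂ A) = ⊤ from congrArg Subrepresentation.toSubmodule h]
          trivial
        exact hx h2
      exact hA ⟨fun p => or_iff_not_imp_left.2 (hc p)⟩
    obtain ⟨p, hp, hp'⟩ := this
    -- Maschke's theorem supplies an invariant complement.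
    obtain ⟨q, hq⟩ := exists_isCompl p
    have hpq : IsCompl p.toSubmodule q.toSubmodule := by
      refine ⟨disjoint_iff.2 ?_, codisjoint_iff.2 ?_⟩
      · exact congrArg Subrepresentation.toSubmodule (disjoint_iff.1 hq.1)
      · exact congrArg Subrepresentation.toSubmodule (codisjoint_iff.1 hq.2)
    have hp1 : p.toSubmodule ≠ ⊤ := fun h => hp' (Subrepresentation.toSubmodule_injective h)
    have hq1 : q.toSubmodule ≠ ⊤ := fun h => hp (by
      have hq2 : q = ⊤ := Subrepresentation.toSubmodule_injective h
      simpa [hq2] using hq.inf_eq_bot)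
    rw [mk_eq_add_of_isCompl A p q hq]
    refine add_mem (ih _ ?_ _ rfl) (ih _ ?_ _ rfl)
    · rw [← hn]; exact Submodule.finrank_lt hp1
    · rw [← hn]; exact Submodule.finrank_lt hq1

lemma span_irr : Submodule.span ℤ (cls '' irr G) = ⊤ := by
  rw [eq_top_iff]
  rintro x -
  obtain ⟨x, rfl⟩ := Ideal.Quotient.mk_surjective x
  induction x using MonoidAlgebra.induction_linear with
  | zero => rw [map_zero]; exact zero_mem _
  | add x y hx hy => rw [map_add]; exact add_mem hx hy
  | single X n =>
    have : (MonoidAlgebra.single X n : MonoidAlgebra ℤ _) = n • MonoidAlgebra.of ℤ _ X := by simp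
    rw [this, map_zsmul, ← mk_out]
    exact Submodule.smul_mem _ _ (mk_mem_closure_irr _)

/-- The bilinear pairing `(x, y) ↦ |G|⁻¹ ∑ χ_x(g) χ_y(g⁻¹)`. -/
def pairing (x y : RepRing G) : ℂ :=
  (Nat.card G : ℂ)⁻¹ * ∑ᶠ g, charHom G x g * charHom G y g⁻¹

omit [Finite G] in
lemma pairing_eq [Fintype G] (x y : RepRing G) :
    pairing x y = (Nat.card G : ℂ)⁻¹ * ∑ g, charHom G x g * charHom G y g⁻¹ := by
  rw [pairing, finsum_eq_sum_of_fintype]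

/-- The pairing as a biadditive map. -/
def pairingHom : RepRing G →ₗ[ℤ] RepRing G →ₗ[ℤ] ℂ :=
  LinearMap.mk₂ ℤ pairing
    (by
      have := Fintype.ofFinite G
      intro x y z
      simp only [pairing_eq, map_add, Pi.add_apply, add_mul, Finset.sum_add_distrib, mul_add])
    (by
      have := Fintype.ofFinite G
      intro n x y
      simp only [pairing_eq, zsmul_eq_mul, map_mul, map_intCast, Pi.mul_apply, Pi.intCast_apply,
        Finset.mul_sum]
      exact Finset.sum_congr rfl fun g _ => by ring)
    (by
      have := Fintype.ofFinite G
      intro x y z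
      simp only [pairing_eq, map_add, Pi.add_apply, Finset.sum_add_distrib, mul_add])
    (by
      have := Fintype.ofFinite G
      intro n x y
      simp only [pairing_eq, zsmul_eq_mul, map_mul, map_intCast, Pi.mul_apply, Pi.intCast_apply,
        Finset.mul_sum]
      exact Finset.sum_congr rfl fun g _ => by ring)

lemma pairingHom_apply (x y : RepRing G) : pairingHom x y = pairing x y := rfl

open Classical in
-- Schur orthogonality. Using g⁻¹ in place of complex conjugation keeps the pairing visibly
-- biadditive.
lemma pairing_cls {X Y : Skeleton (FDRep ℂ G)} (hX : X ∈ irr G) (hY : Y ∈ irr G) :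
    pairing (cls X) (cls Y) = if X = Y then 1 else 0 := by
  have := Fintype.ofFinite G
  have : Invertible (Nat.card G : ℂ) := invertibleOfNonzero (by simp)
  have : Representation.IsIrreducible X.out.ρ := hX
  have : Representation.IsIrreducible Y.out.ρ := hY
  have h := Representation.char_orthonormal X.out.ρ Y.out.ρ
  rw [pairing_eq, cls, cls, charHom_mk, charHom_mk]
  refine h.trans (if_congr ?_ rfl rfl)
  constructor
  · rintro ⟨e⟩
    exact (Quotient.out_equiv_out (s := isIsomorphicSetoid _)).1
      (nonempty_iso_of_equiv e.symm)
  · rintro rfl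
    exact ⟨Representation.Equiv.refl _⟩

/-- Expand x in irreducible classes with integer coefficients: the norm is the sum of their squares,
so exactly one coefficient is nonzero, and it is ±1. -/
lemma exists_eq_or_eq_neg_of_pairing_self_eq_one {x : RepRing G} (hx : pairing x x = 1) :
    ∃ X ∈ irr G, x = cls X ∨ x = -cls X := by
  classical
  have hmem : x ∈ Submodule.span ℤ (cls '' irr G) := span_irr (G := G) ▸ Submodule.mem_top
  obtain ⟨l, hl, rfl⟩ := (Finsupp.mem_span_image_iff_linearCombination ℤ).1 hmem
  rw [Finsupp.mem_supported] at hl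
  have key : ∑ X ∈ l.support, l X ^ 2 = 1 := by
    have : ((∑ X ∈ l.support, l X ^ 2 : ℤ) : ℂ) = 1 := by
      rw [← hx, ← pairingHom_apply, Finsupp.linearCombination_apply, Finsupp.sum, map_sum]
      simp only [LinearMap.sum_apply, map_sum, map_smul, LinearMap.smul_apply, pairingHom_apply]
      push_cast
      refine Finset.sum_congr rfl fun X hX => ?_
      rw [Finset.sum_eq_single X]
      · rw [pairing_cls (hl hX) (hl hX)]; simp [sq]
      · intro Y hY hne
        rw [pairing_cls (hl hY) (hl hX)]; simp [hne]
      · intro h; exact absurd hX h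
    exact_mod_cast this
  have hne : l.support.Nonempty := by
    by_contra h
    rw [Finset.not_nonempty_iff_eq_empty] at h
    simp [h] at key
  obtain ⟨X, hX⟩ := hne
  have hle : 1 ≤ l X ^ 2 := by
    have : l X ≠ 0 := Finsupp.mem_support_iff.1 hX
    have : 0 < l X ^ 2 := by positivity
    omega
  have hsupp : l.support = {X} := by
    refine Finset.eq_singleton_iff_unique_mem.2 ⟨hX, fun Y hY => ?_⟩
    by_contra hYX
    have hY0 : l Y ≠ 0 := Finsupp.mem_support_iff.1 hY
    have hYpos : 0 < l Y ^ 2 := by positivity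
    have h2 := Finset.sum_le_sum_of_subset_of_nonneg (f := fun Z => l Z ^ 2)
      (show ({X, Y} : Finset _) ⊆ l.support by simp [Finset.insert_subset_iff, hX, hY])
      (fun _ _ _ => sq_nonneg _)
    rw [Finset.sum_pair (Ne.symm hYX), key] at h2
    omega
  refine ⟨X, hl hX, ?_⟩
  rw [hsupp, Finset.sum_singleton] at key
  rw [Finsupp.linearCombination_apply, Finsupp.sum, hsupp, Finset.sum_singleton]
  rcases (Int.isUnit_iff.1 (IsUnit.of_mul_eq_one _ ((sq (l X)).symm.trans key))) with h | h <;> simp [h]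

/-- A subring containing elements of norm one whose span contains an element with character
supported at the identity is everything. -/
theorem subring_eq_top (A : Subring (RepRing G)) (S : Set (RepRing G)) (hSA : S ⊆ A)
    (hS : ∀ x ∈ S, pairing x x = 1) (y : RepRing G) (hy : y ∈ Submodule.span ℤ S)
    (hy0 : ∀ g ≠ 1, charHom G y g = 0) (hy1 : charHom G y 1 ≠ 0) : A = ⊤ := by
  have := Fintype.ofFinite G
  have hirr : cls '' irr G ⊆ (A.toAddSubgroup.toIntSubmodule : Set (RepRing G)) := by
    rintro _ ⟨X, hX, rfl⟩
    -- If X were orthogonal to S it would be orthogonal to y; but only g = 1 contributes to the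
    -- pairing of y with X, which is therefore |G|⁻¹ χ_y(1) dim X ≠ 0.
    have hne : ∃ x ∈ S, pairing x (cls X) ≠ 0 := by
      by_contra! hc
      have h0 : pairing y (cls X) = 0 := by
        have : Submodule.span ℤ S ≤ LinearMap.ker (pairingHom.flip (cls X)) :=
          Submodule.span_le.2 fun x hx => hc x hx
        exact this hy
      rw [pairing_eq, Finset.sum_eq_single 1 (fun g _ hg => by rw [hy0 g hg, zero_mul])
        (by simp), inv_one, cls, charHom_mk, FDRep.char_one] at h0
      have : Representation.IsIrreducible X.out.ρ := hX
      have hnt : Nontrivial X.out := by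
        by_contra hs
        rw [not_nontrivial_iff_subsingleton] at hs
        refine bot_ne_top (α := Subrepresentation X.out.ρ)
          (Subrepresentation.toSubmodule_injective (Subsingleton.elim _ _))
      have : Module.finrank ℂ X.out ≠ 0 := Module.finrank_pos.ne'
      simp [hy1, this] at h0
    obtain ⟨x, hx, hxX⟩ := hne
    obtain ⟨Y, hY, h⟩ := exists_eq_or_eq_neg_of_pairing_self_eq_one (hS x hx)
    -- Distinct irreducibles are orthogonal, whereas x = ±[Y] is not orthogonal to [X].
    have hYX : Y = X := by
      by_contra hYX
      have h0 := pairing_cls hY hX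
      rw [if_neg hYX] at h0
      rcases h with rfl | rfl
      · exact hxX h0
      · apply hxX
        rw [← pairingHom_apply] at h0 ⊢
        simp [h0]
    subst hYX
    rcases h with rfl | rfl
    · exact hSA hx
    · simpa using A.neg_mem (hSA hx)
  rw [eq_top_iff]
  rintro x -
  have hmem : x ∈ Submodule.span ℤ (cls '' irr G) := span_irr (G := G) ▸ Submodule.mem_top
  exact Submodule.span_le.2 hirr hmem

end RepRing
end

/-! ### Characters of the Schur functors of one cell and of a column of two cells -/

noncomputable section

section SchurCharacter

/-- The trace of an endomorphism on the range of a quasi-idempotent commuting with it. -/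
lemma LinearMap.trace_restrict_range {E : Type*} [AddCommGroup E] [Module ℂ E]
    [FiniteDimensional ℂ E] (e f : E →ₗ[ℂ] E) {k : ℂ} (hk : k ≠ 0) (he : e ∘ₗ e = k • e)
    (hf : ∀ x ∈ LinearMap.range e, f x ∈ LinearMap.range e) :
    LinearMap.trace ℂ _ (f.restrict hf) = k⁻¹ * LinearMap.trace ℂ E (f ∘ₗ e) := by
  have h1 : f ∘ₗ e = ((LinearMap.range e).subtype ∘ₗ f.restrict hf) ∘ₗ e.rangeRestrict := by
    ext x; simp
  have h2 : e.rangeRestrict ∘ₗ (LinearMap.range e).subtype ∘ₗ f.restrict hf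
      = k • f.restrict hf := by
    ext ⟨x, hx⟩
    obtain ⟨y, hy⟩ := hf x hx
    have := LinearMap.congr_fun he y
    simp only [LinearMap.comp_apply, LinearMap.smul_apply, hy] at this
    simp [this]
  rw [h1, LinearMap.trace_comp_comm', h2, map_smul, smul_eq_mul, inv_mul_cancel_left₀ hk]

variable {G V : Type} [Group G] [AddCommGroup V] [Module ℂ V] [FiniteDimensional ℂ V]

lemma schurFunctor_character (μ : YoungDiagram) (ρ : Representation ℂ G V) {k : ℂ} (hk : k ≠ 0)
    (he : youngSymmetrizer μ V ∘ₗ youngSymmetrizer μ V = k • youngSymmetrizer μ V) (g : G) :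
    (schurFunctor μ ρ).character g
      = k⁻¹ * LinearMap.trace ℂ _ (cellTensorRep μ ρ g ∘ₗ youngSymmetrizer μ V) :=
  LinearMap.trace_restrict_range _ _ hk he ((schurSubrep μ ρ).apply_mem_toSubmodule g)

omit [FiniteDimensional ℂ V] in
-- The sum factors over the cycles of p, a cycle of length r giving tr(fʳ). Here it serves for the
-- identity and for one transposition.
lemma trace_map_comp_permTensor (μ : YoungDiagram) {ι : Type} [Fintype ι] [DecidableEq ι]
    (b : Module.Basis ι ℂ V) (f : V →ₗ[ℂ] V) (p : Equiv.Perm μ.cells) :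
    LinearMap.trace ℂ (CellTensor μ V)
        ((PiTensorProduct.map fun _ : μ.cells => f) ∘ₗ permTensor μ V p)
      = ∑ φ : μ.cells → ι, ∏ c, LinearMap.toMatrix b b f (φ c) (φ (p.symm c)) := by
  rw [LinearMap.trace_eq_matrix_trace ℂ (Basis.piTensorProduct fun _ : μ.cells => b),
    Matrix.trace]
  refine Finset.sum_congr rfl fun φ _ => ?_
  rw [Matrix.diag_apply, LinearMap.toMatrix_apply, Basis.piTensorProduct_apply,
    LinearMap.comp_apply, permTensor, LinearEquiv.coe_coe, PiTensorProduct.reindex_tprod,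
    PiTensorProduct.map_tprod, Basis.piTensorProduct_repr_tprod_apply]
  exact Finset.prod_congr rfl fun c _ => (LinearMap.toMatrix_apply _ _ _ _ _).symm

/-- The diagram with one cell. -/
def oneCell : YoungDiagram where
  cells := {(0, 0)}
  isLowerSet := by
    rintro ⟨a, b⟩ ⟨c, d⟩ h
    simp only [Prod.mk_le_mk] at h
    simp
    omega

/-- The diagram with one column of two cells. -/
def twoColumn : YoungDiagram where
  cells := {(0, 0), (1, 0)}
  isLowerSet := by
    rintro ⟨a, b⟩ ⟨c, d⟩ h
    simp only [Prod.mk_le_mk] at h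
    simp
    omega

instance : Unique oneCell.cells := ⟨⟨⟨(0, 0), by decide⟩⟩, by decide⟩

/-- The two cells of `twoColumn`. -/
def twoColumnEquiv : Fin 2 ≃ twoColumn.cells where
  toFun := ![(⟨(0, 0), by decide⟩ : twoColumn.cells), ⟨(1, 0), by decide⟩]
  invFun c := if c.1 = (0, 0) then 0 else 1
  left_inv := by decide
  right_inv := by decide

/-- The transposition of the cells of `twoColumn`. -/
def twoColumnSwap : Equiv.Perm twoColumn.cells := Equiv.swap (twoColumnEquiv 0) (twoColumnEquiv 1)

omit [FiniteDimensional ℂ V] in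
lemma permTensor_one (μ : YoungDiagram) : permTensor μ V 1 = LinearMap.id := by
  ext; simp [permTensor]; rfl

omit [FiniteDimensional ℂ V] in
lemma permTensor_comp (μ : YoungDiagram) (p q : Equiv.Perm μ.cells) :
    permTensor μ V p ∘ₗ permTensor μ V q = permTensor μ V (p * q) := by
  ext; simp [permTensor, Equiv.Perm.mul_def]

omit [FiniteDimensional ℂ V] in
lemma youngSymmetrizer_oneCell : youngSymmetrizer oneCell V = permTensor oneCell V 1 := by
  have h1 : (Finset.univ.filter fun p : Equiv.Perm oneCell.cells => ∀ c, (p c).1.1 = c.1.1) = {1} :=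
    by decide
  have h2 : (Finset.univ.filter fun p : Equiv.Perm oneCell.cells => ∀ c, (p c).1.2 = c.1.2) = {1} :=
    by decide
  rw [youngSymmetrizer, h1, h2]
  simp only [Finset.sum_singleton, Equiv.Perm.sign_one]
  simp [permTensor_one]

omit [FiniteDimensional ℂ V] in
lemma youngSymmetrizer_twoColumn :
    youngSymmetrizer twoColumn V = LinearMap.id - permTensor twoColumn V twoColumnSwap := by
  have h1 : (Finset.univ.filter fun p : Equiv.Perm twoColumn.cells => ∀ c, (p c).1.1 = c.1.1)
      = {1} := by decide
  have h2 : (Finset.univ.filter fun p : Equiv.Perm twoColumn.cells => ∀ c, (p c).1.2 = c.1.2)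
      = {1, twoColumnSwap} := by decide
  have h3 : (1 : Equiv.Perm twoColumn.cells) ≠ twoColumnSwap := by decide
  have h4 : Equiv.Perm.sign twoColumnSwap = -1 := by decide
  rw [youngSymmetrizer, h1, h2]
  simp only [Finset.sum_singleton, Finset.sum_pair h3, h4, permTensor_one, Equiv.Perm.sign_one,
    LinearMap.id_comp, Units.val_one, Units.val_neg, one_smul, neg_smul, sub_eq_add_neg]

lemma character_oneCell (ρ : Representation ℂ G V) (g : G) :
    (schurFunctor oneCell ρ).character g = LinearMap.trace ℂ V (ρ g) := by
  rw [schurFunctor_character (k := 1) _ _ one_ne_zero (by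
    rw [youngSymmetrizer_oneCell, permTensor_one]; simp), youngSymmetrizer_oneCell]
  refine (congrArg _ (trace_map_comp_permTensor oneCell (Module.finBasis ℂ V) (ρ g) 1)).trans ?_
  rw [LinearMap.trace_eq_matrix_trace ℂ (Module.finBasis ℂ V), inv_one, one_mul]
  exact Fintype.sum_equiv (Equiv.funUnique _ _) _ _ fun φ => by
    simp [Matrix.diag, show (Equiv.symm (1 : Equiv.Perm oneCell.cells)) = 1 from rfl]

/-- The symmetrizer is e = 1 - τ with τ the swap, so e² = 2e. The formula follows from tr(f ⊗ f) =
(tr f)² and tr((f ⊗ f)τ) = tr(f²). -/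
lemma character_twoColumn (ρ : Representation ℂ G V) (g : G) :
    (schurFunctor twoColumn ρ).character g
      = (LinearMap.trace ℂ V (ρ g) ^ 2 - LinearMap.trace ℂ V (ρ (g * g))) / 2 := by
  have hsq : twoColumnSwap * twoColumnSwap = 1 := Equiv.swap_mul_self _ _
  rw [schurFunctor_character (k := 2) _ _ two_ne_zero (by
    rw [youngSymmetrizer_twoColumn, LinearMap.sub_comp, LinearMap.comp_sub, LinearMap.comp_sub,
      permTensor_comp, hsq, permTensor_one, two_smul]
    simp only [LinearMap.id_comp, LinearMap.comp_id]
    abel), youngSymmetrizer_twoColumn, LinearMap.comp_sub, map_sub, ← permTensor_one]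
  have h (p) := trace_map_comp_permTensor twoColumn (Module.finBasis ℂ V) (ρ g) p
  change _ * (LinearMap.trace ℂ _ ((PiTensorProduct.map fun _ => ρ g) ∘ₗ _)
    - LinearMap.trace ℂ _ ((PiTensorProduct.map fun _ => ρ g) ∘ₗ _)) = _
  rw [h, h, map_mul, LinearMap.trace_eq_matrix_trace ℂ (Module.finBasis ℂ V),
    LinearMap.trace_eq_matrix_trace ℂ (Module.finBasis ℂ V), LinearMap.toMatrix_mul]
  set N := LinearMap.toMatrix (Module.finBasis ℂ V) (Module.finBasis ℂ V) (ρ g)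
  -- Index assignments of the two cells are rewritten as pairs (i, j), so that both traces become
  -- double sums.
  have hsum (p : Equiv.Perm twoColumn.cells) :
      ∑ φ : twoColumn.cells → Fin (Module.finrank ℂ V), ∏ c, N (φ c) (φ (p.symm c))
        = ∑ i, ∑ j, ∏ c, N (![i, j] (twoColumnEquiv.symm c))
            (![i, j] (twoColumnEquiv.symm (p.symm c))) := by
    rw [← Fintype.sum_prod_type']
    refine Fintype.sum_equiv ((twoColumnEquiv.symm.arrowCongr (Equiv.refl _)).trans
      (finTwoArrowEquiv _)) _ _ fun φ => ?_
    have hφ (c) : ![φ (twoColumnEquiv 0), φ (twoColumnEquiv 1)] (twoColumnEquiv.symm c) = φ c := by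
      obtain ⟨i, rfl⟩ := twoColumnEquiv.surjective c
      rw [Equiv.symm_apply_apply]
      fin_cases i <;> rfl
    refine Finset.prod_congr rfl fun c _ => ?_
    change _ = N (![φ (twoColumnEquiv 0), φ (twoColumnEquiv 1)] (twoColumnEquiv.symm c))
      (![φ (twoColumnEquiv 0), φ (twoColumnEquiv 1)] (twoColumnEquiv.symm (p.symm c)))
    rw [hφ, hφ]
  rw [hsum, hsum]
  have hprod (F : twoColumn.cells → ℂ) : ∏ c, F c = F (twoColumnEquiv 0) * F (twoColumnEquiv 1) := by
    rw [← Equiv.prod_comp twoColumnEquiv, Fin.prod_univ_two]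
  simp only [hprod, twoColumnSwap, Equiv.symm_swap, Equiv.swap_apply_left, Equiv.swap_apply_right,
    Equiv.symm_apply_apply]
  simp only [Matrix.trace, Matrix.diag_apply, Matrix.mul_apply, sq, Finset.sum_mul_sum]
  simp [show (Equiv.symm (1 : Equiv.Perm twoColumn.cells)) = 1 from rfl]
  ring

end SchurCharacter
end

/-! ### Integer coordinates for the icosians and the finite verifications -/

noncomputable section

open Quaternion

section Icosians

/-- Coordinates of a quaternion over `½ℤ[φ]`: `⟨x₀, y₀, …, x₃, y₃⟩` stands for the quaternion with
coordinates `(xᵢ + yᵢ φ) / 2`. -/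
@[ext]
structure IcoCoord where
  (x0 y0 x1 y1 x2 y2 x3 y3 : ℤ)
  deriving DecidableEq

namespace IcoCoord

/-- The golden ratio as a complex number. -/
def phi : ℂ := (Real.goldenRatio : ℝ)

lemma phi_sq : phi ^ 2 = phi + 1 := by
  rw [phi, ← Complex.ofReal_pow, Real.goldenRatio_sq, Complex.ofReal_add, Complex.ofReal_one]

/-- The golden ratio is irrational. -/
lemma phi_lin_injective {x y x' y' : ℤ} (h : (x : ℂ) + y * phi = x' + y' * phi) :
    x = x' ∧ y = y' := by
  have hr : (x : ℝ) + y * Real.goldenRatio = x' + y' * Real.goldenRatio := by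
    apply Complex.ofReal_injective
    simp only [Complex.ofReal_add, Complex.ofReal_mul, Complex.ofReal_intCast]
    exact h
  have hy : y = y' := by
    by_contra hne
    have hne' : ((y - y' : ℤ) : ℝ) ≠ 0 := by exact_mod_cast sub_ne_zero.2 hne
    refine Real.goldenRatio_irrational ⟨((x' - x : ℤ) : ℚ) / ((y - y' : ℤ) : ℚ), ?_⟩
    rw [Rat.cast_div, Rat.cast_intCast, Rat.cast_intCast, div_eq_iff hne']
    push_cast
    linarith
  subst hy
  exact ⟨by exact_mod_cast add_right_cancel hr, rfl⟩

/-- The quaternion with given coordinates. -/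
def ev (p : IcoCoord) : ℍ[ℂ] :=
  ⟨(p.x0 + p.y0 * phi) / 2, (p.x1 + p.y1 * phi) / 2, (p.x2 + p.y2 * phi) / 2,
    (p.x3 + p.y3 * phi) / 2⟩

@[simp] lemma re_ev (p : IcoCoord) : (ev p).re = (p.x0 + p.y0 * phi) / 2 := rfl

@[simp] lemma imI_ev (p : IcoCoord) : (ev p).imI = (p.x1 + p.y1 * phi) / 2 := rfl

@[simp] lemma imJ_ev (p : IcoCoord) : (ev p).imJ = (p.x2 + p.y2 * phi) / 2 := rfl

@[simp] lemma imK_ev (p : IcoCoord) : (ev p).imK = (p.x3 + p.y3 * phi) / 2 := rfl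

lemma ev_injective : Function.Injective ev := by
  intro p q h
  have h0 := congrArg QuaternionAlgebra.re h
  have h1 := congrArg QuaternionAlgebra.imI h
  have h2 := congrArg QuaternionAlgebra.imJ h
  have h3 := congrArg QuaternionAlgebra.imK h
  simp only [re_ev, imI_ev, imJ_ev, imK_ev, div_left_inj' (two_ne_zero (α := ℂ))] at h0 h1 h2 h3
  obtain ⟨a0, b0⟩ := phi_lin_injective h0
  obtain ⟨a1, b1⟩ := phi_lin_injective h1
  obtain ⟨a2, b2⟩ := phi_lin_injective h2
  obtain ⟨a3, b3⟩ := phi_lin_injective h3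
  ext <;> assumption

/-- Twice the coordinates. -/
def dbl (p : IcoCoord) : IcoCoord :=
  ⟨2 * p.x0, 2 * p.y0, 2 * p.x1, 2 * p.y1, 2 * p.x2, 2 * p.y2, 2 * p.x3, 2 * p.y3⟩

/-- Half the coordinates, rounded. -/
def half (p : IcoCoord) : IcoCoord :=
  ⟨p.x0 / 2, p.y0 / 2, p.x1 / 2, p.y1 / 2, p.x2 / 2, p.y2 / 2, p.x3 / 2, p.y3 / 2⟩

/-- Coordinates of the conjugate. -/
def conj (p : IcoCoord) : IcoCoord :=
  ⟨p.x0, p.y0, -p.x1, -p.y1, -p.x2, -p.y2, -p.x3, -p.y3⟩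

/-- Coordinates of the unit. -/
def unit : IcoCoord := ⟨2, 0, 0, 0, 0, 0, 0, 0⟩

/-- Twice the coordinates of the product. -/
def mulD (p q : IcoCoord) : IcoCoord where
  x0 := p.x0 * q.x0 + p.y0 * q.y0 - (p.x1 * q.x1 + p.y1 * q.y1) - (p.x2 * q.x2 + p.y2 * q.y2)
    - (p.x3 * q.x3 + p.y3 * q.y3)
  y0 := p.x0 * q.y0 + p.y0 * q.x0 + p.y0 * q.y0 - (p.x1 * q.y1 + p.y1 * q.x1 + p.y1 * q.y1)
    - (p.x2 * q.y2 + p.y2 * q.x2 + p.y2 * q.y2) - (p.x3 * q.y3 + p.y3 * q.x3 + p.y3 * q.y3)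
  x1 := p.x0 * q.x1 + p.y0 * q.y1 + (p.x1 * q.x0 + p.y1 * q.y0) + (p.x2 * q.x3 + p.y2 * q.y3)
    - (p.x3 * q.x2 + p.y3 * q.y2)
  y1 := p.x0 * q.y1 + p.y0 * q.x1 + p.y0 * q.y1 + (p.x1 * q.y0 + p.y1 * q.x0 + p.y1 * q.y0)
    + (p.x2 * q.y3 + p.y2 * q.x3 + p.y2 * q.y3) - (p.x3 * q.y2 + p.y3 * q.x2 + p.y3 * q.y2)
  x2 := p.x0 * q.x2 + p.y0 * q.y2 - (p.x1 * q.x3 + p.y1 * q.y3) + (p.x2 * q.x0 + p.y2 * q.y0)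
    + (p.x3 * q.x1 + p.y3 * q.y1)
  y2 := p.x0 * q.y2 + p.y0 * q.x2 + p.y0 * q.y2 - (p.x1 * q.y3 + p.y1 * q.x3 + p.y1 * q.y3)
    + (p.x2 * q.y0 + p.y2 * q.x0 + p.y2 * q.y0) + (p.x3 * q.y1 + p.y3 * q.x1 + p.y3 * q.y1)
  x3 := p.x0 * q.x3 + p.y0 * q.y3 + (p.x1 * q.x2 + p.y1 * q.y2) - (p.x2 * q.x1 + p.y2 * q.y1)
    + (p.x3 * q.x0 + p.y3 * q.y0)
  y3 := p.x0 * q.y3 + p.y0 * q.x3 + p.y0 * q.y3 + (p.x1 * q.y2 + p.y1 * q.x2 + p.y1 * q.y2)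
    - (p.x2 * q.y1 + p.y2 * q.x1 + p.y2 * q.y1) + (p.x3 * q.y0 + p.y3 * q.x0 + p.y3 * q.y0)

/-- Both factors carry a denominator 2 and the product only one, hence the doubling of r. In each
coordinate the coefficient of `h2` collects the φ² terms to be replaced by φ + 1. -/
lemma ev_mul {p q r : IcoCoord} (h : mulD p q = dbl r) : ev p * ev q = ev r := by
  have h2 := phi_sq
  rw [IcoCoord.ext_iff] at h
  obtain ⟨a0, b0, a1, b1, a2, b2, a3, b3⟩ := h
  simp only [mulD, dbl] at a0 b0 a1 b1 a2 b2 a3 b3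
  ext
  · have a : (_ : ℂ) = _ := congrArg Int.cast a0
    have b : (_ : ℂ) = _ := congrArg Int.cast b0
    push_cast at a b
    simp only [re_ev, imI_ev, imJ_ev, imK_ev, re_mul]
    linear_combination a / 4 + b / 4 * phi
      + (p.y0 * q.y0 - p.y1 * q.y1 - p.y2 * q.y2 - p.y3 * q.y3) / 4 * h2
  · have a : (_ : ℂ) = _ := congrArg Int.cast a1
    have b : (_ : ℂ) = _ := congrArg Int.cast b1
    push_cast at a b
    simp only [re_ev, imI_ev, imJ_ev, imK_ev, imI_mul]
    linear_combination a / 4 + b / 4 * phi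
      + (p.y0 * q.y1 + p.y1 * q.y0 + p.y2 * q.y3 - p.y3 * q.y2) / 4 * h2
  · have a : (_ : ℂ) = _ := congrArg Int.cast a2
    have b : (_ : ℂ) = _ := congrArg Int.cast b2
    push_cast at a b
    simp only [re_ev, imI_ev, imJ_ev, imK_ev, imJ_mul]
    linear_combination a / 4 + b / 4 * phi
      + (p.y0 * q.y2 - p.y1 * q.y3 + p.y2 * q.y0 + p.y3 * q.y1) / 4 * h2
  · have a : (_ : ℂ) = _ := congrArg Int.cast a3
    have b : (_ : ℂ) = _ := congrArg Int.cast b3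
    push_cast at a b
    simp only [re_ev, imI_ev, imJ_ev, imK_ev, imK_mul]
    linear_combination a / 4 + b / 4 * phi
      + (p.y0 * q.y3 + p.y1 * q.y2 - p.y2 * q.y1 + p.y3 * q.y0) / 4 * h2

lemma ev_conj (p : IcoCoord) : ev (conj p) = star (ev p) := by
  ext <;> simp [conj] <;> ring

lemma ev_unit : ev unit = 1 := by
  ext <;> simp [unit]

/-- The three simple roots other than `1`. -/
def root : Fin 3 → IcoCoord := ![⟨0, 0, 0, 0, 2, 0, 0, 0⟩, ⟨0, 0, 0, 1, -1, 0, 1, -1⟩, ⟨0, -1, -1, 0, 0, 0, -1, 1⟩]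

/-- The binary icosahedral group. -/
def table : List IcoCoord := [
  ⟨2, 0, 0, 0, 0, 0, 0, 0⟩, ⟨0, 0, 0, 0, 2, 0, 0, 0⟩, ⟨0, 0, 0, 1, -1, 0, 1, -1⟩,
  ⟨0, -1, -1, 0, 0, 0, -1, 1⟩, ⟨-2, 0, 0, 0, 0, 0, 0, 0⟩, ⟨1, 0, -1, 1, 0, 0, 0, 1⟩,
  ⟨0, 0, 1, -1, 0, -1, -1, 0⟩, ⟨1, 0, 1, -1, 0, 0, 0, -1⟩, ⟨1, 0, -1, 0, 1, 0, 1, 0⟩,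
  ⟨0, 0, -1, 1, 0, -1, 1, 0⟩, ⟨1, 0, 0, -1, -1, 1, 0, 0⟩, ⟨-1, 1, 0, 1, 0, 0, -1, 0⟩,
  ⟨0, 0, 0, 0, -2, 0, 0, 0⟩, ⟨0, 0, 0, -1, 1, 0, -1, 1⟩, ⟨0, 1, 1, 0, 0, 0, 1, -1⟩,
  ⟨0, 0, 0, 1, 1, 0, 1, -1⟩, ⟨-1, 0, -1, 0, 1, 0, -1, 0⟩, ⟨0, 1, -1, 0, 0, 0, -1, 1⟩,
  ⟨1, -1, 0, 0, 1, 0, 0, -1⟩, ⟨0, 0, 1, 0, -1, 1, 0, 1⟩, ⟨1, -1, 0, 0, -1, 0, 0, 1⟩,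
  ⟨-1, 0, 1, 0, 1, 0, 1, 0⟩, ⟨0, 1, -1, 1, -1, 0, 0, 0⟩, ⟨0, -1, 0, 0, 1, -1, -1, 0⟩,
  ⟨-1, 0, -1, 0, -1, 0, -1, 0⟩, ⟨1, -1, 0, 0, 1, 0, 0, 1⟩, ⟨0, -1, -1, 1, -1, 0, 0, 0⟩,
  ⟨0, 0, -1, 0, -1, 1, 0, -1⟩, ⟨0, -1, 1, 0, 0, 0, -1, 1⟩, ⟨-1, 1, 0, -1, 0, 0, 1, 0⟩,
  ⟨-1, 0, 1, -1, 0, 0, 0, -1⟩, ⟨0, 0, -1, 1, 0, 1, 1, 0⟩, ⟨-1, 0, -1, 1, 0, 0, 0, 1⟩,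
  ⟨-1, 0, 1, 0, -1, 0, -1, 0⟩, ⟨0, 0, 1, -1, 0, 1, -1, 0⟩, ⟨-1, 0, 0, 1, 1, -1, 0, 0⟩,
  ⟨1, -1, 0, -1, 0, 0, 1, 0⟩, ⟨1, 0, 0, -1, 1, -1, 0, 0⟩, ⟨-1, 0, -1, 0, -1, 0, 1, 0⟩,
  ⟨1, 0, 0, 0, 0, 1, -1, 1⟩, ⟨-1, 1, 1, 0, 0, -1, 0, 0⟩, ⟨1, 0, 1, 0, -1, 0, -1, 0⟩,
  ⟨-1, 0, 0, -1, 1, -1, 0, 0⟩, ⟨1, 0, 0, 0, 0, -1, -1, 1⟩, ⟨1, -1, 0, 1, 0, 0, -1, 0⟩,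
  ⟨0, 0, 1, -1, 0, -1, 1, 0⟩, ⟨1, 0, 0, 1, 1, -1, 0, 0⟩, ⟨0, 0, 0, -1, -1, 0, 1, -1⟩,
  ⟨0, 0, -1, 1, 0, 1, -1, 0⟩, ⟨0, 0, -1, 0, 1, -1, 0, 1⟩, ⟨1, 0, 0, 0, 0, 1, 1, -1⟩,
  ⟨-1, 0, -1, 0, 1, 0, 1, 0⟩, ⟨-1, 1, -1, 0, 0, -1, 0, 0⟩, ⟨1, -1, -1, 0, 0, 1, 0, 0⟩,
  ⟨0, 1, 1, 0, 0, 0, -1, 1⟩, ⟨1, 0, -1, 0, -1, 0, 1, 0⟩, ⟨-1, 1, 0, 1, 0, 0, 1, 0⟩,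
  ⟨0, 0, 0, 0, 0, 0, -2, 0⟩, ⟨1, 0, 0, 0, 0, -1, 1, -1⟩, ⟨-1, 0, 0, -1, -1, 1, 0, 0⟩,
  ⟨0, 1, -1, 1, 1, 0, 0, 0⟩, ⟨-1, 1, 1, 0, 0, 1, 0, 0⟩, ⟨0, 0, -1, 1, 0, -1, -1, 0⟩,
  ⟨0, 1, 0, 0, -1, 1, -1, 0⟩, ⟨0, 1, 0, 0, 1, -1, -1, 0⟩, ⟨0, -1, 1, 0, 0, 0, 1, -1⟩,
  ⟨0, 0, 0, -1, -1, 0, -1, 1⟩, ⟨1, 0, 1, 0, -1, 0, 1, 0⟩, ⟨-1, 1, 0, 0, -1, 0, 0, 1⟩,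
  ⟨0, 0, -1, 0, 1, -1, 0, -1⟩, ⟨-1, 1, 0, 0, 1, 0, 0, -1⟩, ⟨1, 0, -1, 0, -1, 0, -1, 0⟩,
  ⟨0, -1, 1, -1, 1, 0, 0, 0⟩, ⟨0, 1, 0, 0, -1, 1, 1, 0⟩, ⟨1, 0, 1, 0, 1, 0, 1, 0⟩,
  ⟨-1, 1, 0, 0, -1, 0, 0, -1⟩, ⟨0, 1, 1, -1, 1, 0, 0, 0⟩, ⟨0, 0, 1, 0, 1, -1, 0, 1⟩,
  ⟨0, 1, -1, 0, 0, 0, 1, -1⟩, ⟨-1, 1, 0, 0, 1, 0, 0, 1⟩, ⟨1, 0, -1, 1, 0, 0, 0, -1⟩,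
  ⟨-1, 1, 0, -1, 0, 0, -1, 0⟩, ⟨0, -1, -1, 1, 1, 0, 0, 0⟩, ⟨0, 0, 1, -1, 0, 1, 1, 0⟩,
  ⟨1, 0, -1, 0, 1, 0, -1, 0⟩, ⟨0, 0, -1, 0, -1, 1, 0, 1⟩, ⟨0, 0, 2, 0, 0, 0, 0, 0⟩,
  ⟨1, -1, 0, 0, -1, 0, 0, -1⟩, ⟨-1, 0, 0, 0, 0, 1, -1, 1⟩, ⟨0, -1, 0, 0, -1, 1, 1, 0⟩,
  ⟨1, -1, 1, 0, 0, 1, 0, 0⟩, ⟨1, 0, 1, -1, 0, 0, 0, 1⟩, ⟨1, -1, 0, 1, 0, 0, 1, 0⟩,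
  ⟨0, -1, -1, 0, 0, 0, 1, -1⟩, ⟨-1, 0, 1, 0, 1, 0, -1, 0⟩, ⟨1, -1, -1, 0, 0, -1, 0, 0⟩,
  ⟨-1, 0, 1, 0, -1, 0, 1, 0⟩, ⟨0, 0, 1, 0, 1, -1, 0, -1⟩, ⟨0, -1, 0, 0, 1, -1, 1, 0⟩,
  ⟨1, -1, 1, 0, 0, -1, 0, 0⟩, ⟨0, 0, 1, 0, -1, 1, 0, -1⟩, ⟨-1, 0, 0, 0, 0, -1, -1, 1⟩,
  ⟨0, 0, 0, -1, 1, 0, 1, -1⟩, ⟨0, 0, -2, 0, 0, 0, 0, 0⟩, ⟨-1, 0, -1, 1, 0, 0, 0, -1⟩,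
  ⟨-1, 0, 0, 0, 0, 1, 1, -1⟩, ⟨0, 0, 0, 1, -1, 0, -1, 1⟩, ⟨0, -1, 0, 0, -1, 1, -1, 0⟩,
  ⟨-1, 1, -1, 0, 0, 1, 0, 0⟩, ⟨-1, 0, 1, -1, 0, 0, 0, 1⟩, ⟨-1, 0, 0, 1, -1, 1, 0, 0⟩,
  ⟨1, 0, 1, 0, 1, 0, -1, 0⟩, ⟨-1, 0, 0, 0, 0, -1, 1, -1⟩, ⟨1, 0, 0, 1, -1, 1, 0, 0⟩,
  ⟨0, 0, 0, 1, 1, 0, -1, 1⟩, ⟨1, -1, 0, -1, 0, 0, -1, 0⟩, ⟨0, 0, 0, 0, 0, 0, 2, 0⟩,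
  ⟨0, -1, 1, -1, -1, 0, 0, 0⟩, ⟨0, 1, 0, 0, 1, -1, 1, 0⟩, ⟨0, 1, 1, -1, -1, 0, 0, 0⟩]

/-- Each entry of `table` but the first as a simple root times an earlier entry. -/
def parents : List (Fin 3 × ℕ) := [
  (0, 0), (0, 0), (1, 0), (2, 0), (0, 1), (1, 1), (2, 1), (0, 2), (2, 2), (0, 3), (1, 3), (2, 3),
  (0, 4), (1, 4), (2, 4), (0, 5), (2, 5), (0, 6), (1, 6), (2, 6), (2, 7), (0, 8), (1, 8), (2, 8),
  (1, 9), (0, 10), (2, 10), (0, 11), (1, 11), (2, 11), (1, 12), (2, 12), (0, 13), (2, 13),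
  (0, 14), (1, 14), (2, 14), (2, 15), (0, 16), (1, 16), (2, 16), (1, 17), (0, 18), (2, 18),
  (0, 19), (1, 19), (0, 20), (1, 20), (2, 20), (1, 21), (0, 22), (2, 22), (0, 23), (1, 23),
  (2, 23), (0, 24), (2, 24), (2, 25), (0, 26), (1, 26), (2, 26), (1, 27), (0, 28), (2, 28),
  (1, 29), (2, 29), (0, 30), (2, 30), (1, 31), (2, 31), (2, 32), (0, 33), (1, 33), (2, 33),
  (1, 34), (0, 35), (2, 35), (0, 36), (1, 36), (0, 37), (1, 37), (1, 38), (0, 39), (2, 40),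
  (0, 41), (2, 41), (2, 42), (1, 43), (2, 43), (1, 44), (2, 45), (0, 47), (2, 47), (0, 48),
  (2, 49), (2, 50), (0, 51), (2, 51), (0, 53), (1, 54), (0, 56), (1, 56), (2, 56), (0, 57),
  (1, 58), (0, 60), (1, 60), (0, 61), (0, 64), (2, 64), (2, 66), (0, 67), (1, 67), (0, 68),
  (1, 70), (2, 74), (2, 75), (2, 76), (1, 83), (1, 85)]

lemma table_length : table.length = 120 := by decide +kernel

lemma table_nodup : table.Nodup := by decide +kernel

lemma mulD_conj_of_mem : ∀ p ∈ table, mulD p (conj p) = dbl unit ∧ mulD (conj p) p = dbl unit := by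
  decide +kernel

/-- The table is stable under left multiplication by the generators: this bounds the generated group
from above, and `parents_spec` bounds it from below. -/
lemma mulD_root_mem : ∀ j, ∀ p ∈ table, mulD (root j) p ∈ table.map dbl := by decide +kernel

/-- `parents` is indexed like `table`; its entry at index 0, which belongs to the unit, is a
placeholder. -/
lemma parents_spec : ∀ i < 120, i = 0 ∨ (parents.getD i (0, 0)).2 < i ∧
    mulD (root (parents.getD i (0, 0)).1) (table.getD (parents.getD i (0, 0)).2 unit)
      = dbl (table.getD i unit) := by decide +kernel

lemma root_mem : ∀ j, root j ∈ table := by decide +kernel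

lemma neg_unit_mem : (⟨-2, 0, 0, 0, 0, 0, 0, 0⟩ : IcoCoord) ∈ table := by decide +kernel

/-- The pair (x₀, y₀) records the reduced trace x₀ + y₀φ. Its nine values, with these
multiplicities, are all that character sums over the group require. -/
lemma table_traces : List.Perm (table.map fun p => (p.x0, p.y0))
    ((2, 0) :: (-2, 0) :: (List.replicate 30 (0, 0) ++ (List.replicate 20 (1, 0) ++
      (List.replicate 20 (-1, 0) ++ (List.replicate 12 (0, 1) ++ (List.replicate 12 (0, -1) ++
      (List.replicate 12 (1, -1) ++ List.replicate 12 (-1, 1)))))))) := by decide +kernel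

/-- A generator or its inverse. -/
def letter (l : Fin 3 × Bool) : IcoCoord := if l.2 then root l.1 else conj (root l.1)

/-- Evaluates a word by division from the left and compares the result with `q`. -/
def checkWord (f : Fin 3 × Bool → IcoCoord) : List (Fin 3 × Bool) → IcoCoord → Bool
  | [], q => decide (q = unit)
  | l :: w, q =>
    decide (mulD (f l) (half (mulD (conj (f l)) q)) = dbl q) &&
      checkWord f w (half (mulD (conj (f l)) q))

/-- The rounding in `half` is harmless: each step tests that multiplying back by the letter recovers
q. -/
lemma ev_of_checkWord (f : Fin 3 × Bool → IcoCoord) (w : List (Fin 3 × Bool)) (q : IcoCoord)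
    (h : checkWord f w q = true) : (w.map fun l => ev (f l)).prod = ev q := by
  induction w generalizing q with
  | nil =>
    rw [checkWord, decide_eq_true_eq] at h
    rw [h, ev_unit]; rfl
  | cons l w ih =>
    rw [checkWord, Bool.and_eq_true, decide_eq_true_eq] at h
    rw [List.map_cons, List.prod_cons, ih _ h.2, ev_mul h.1]

/-- Words expressing `(root j, 1)` in the elements `(root i, (root i)⁻¹)`. -/
def commWord : Fin 3 → List (Fin 3 × Bool) := ![
  [(2, false), (2, false), (1, true), (2, true), (0, true), (1, true), (2, true), (2, true), (1, true), (2, false), (2, false), (0, true), (1, true), (2, false), (2, false), (1, true), (2, true), (2, true), (0, true), (1, true)],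
  [(0, true), (1, true), (2, false), (2, false), (1, true), (2, true), (0, true), (1, true), (2, true), (2, true), (1, true), (2, false), (2, false), (0, true), (1, true), (2, false), (2, false), (1, true), (2, true), (2, true)],
  [(2, false), (1, true), (2, true), (2, true), (1, true), (2, false), (2, false), (0, true), (1, true), (2, false), (2, false), (1, true), (2, true), (0, true), (1, true), (2, true), (2, true), (1, true), (2, false), (0, true), (1, true), (2, false), (1, true), (2, true), (1, true), (2, false), (0, true), (1, true), (2, false), (2, false), (1, true), (0, true)]]

/-- Conjugation inverts unit quaternions, so the second check evaluates the same word at the inverse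
generators. These words isolate one factor of I × I inside the group generated by the pairs (r,
r⁻¹). -/
lemma checkWord_commWord : ∀ j, checkWord letter (commWord j) (root j) = true ∧
    checkWord (fun l => conj (letter l)) (commWord j) unit = true := by decide +kernel

end IcoCoord

end Icosians
end

/-! ### The binary icosahedral group and its reduced traces -/

noncomputable section

open Quaternion IcoCoord

section IcosianGroup

lemma ev_mem_unitary {p : IcoCoord} (hp : p ∈ table) : ev p ∈ unitary ℍ[ℂ] := by
  obtain ⟨h1, h2⟩ := mulD_conj_of_mem p hp
  rw [Unitary.mem_iff, ← ev_conj, ev_mul h1, ev_mul h2]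
  exact ⟨ev_unit, ev_unit⟩

/-- The simple roots other than `1` as unit quaternions. -/
def unitRoot (j : Fin 3) : unitary ℍ[ℂ] := ⟨ev (root j), ev_mem_unitary (root_mem j)⟩

/-- The binary icosahedral group of unit quaternions. -/
def icosians : Subgroup (unitary ℍ[ℂ]) := Subgroup.closure (Set.range unitRoot)

lemma table_subset_icosians (i : ℕ) (hi : i < 120) :
    ∃ x ∈ icosians, (x : ℍ[ℂ]) = ev (table.getD i unit) := by
  induction i using Nat.strong_induction_on with
  | _ i ih =>
  rcases parents_spec i hi with rfl | ⟨h1, h2⟩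
  · exact ⟨1, one_mem _, ev_unit.symm⟩
  · obtain ⟨x, hx, hxe⟩ := ih _ h1 (h1.trans hi)
    refine ⟨unitRoot (parents.getD i (0, 0)).1 * x,
      mul_mem (Subgroup.subset_closure ⟨_, rfl⟩) hx, ?_⟩
    rw [← ev_mul h2, ← hxe]
    rfl

lemma mem_icosians_iff {x : unitary ℍ[ℂ]} : x ∈ icosians ↔ ∃ p ∈ table, ev p = x := by
  constructor
  · have hmul (j : Fin 3) (y : unitary ℍ[ℂ]) (hy : ∃ p ∈ table, ev p = y) :
        ∃ p ∈ table, ev p = (unitRoot j * y : unitary ℍ[ℂ]) := by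
      obtain ⟨p, hp, hpy⟩ := hy
      obtain ⟨q, hq, hqp⟩ := List.mem_map.1 (mulD_root_mem j p hp)
      refine ⟨q, hq, ?_⟩
      rw [← ev_mul hqp.symm, hpy]
      rfl
    let X : Set (unitary ℍ[ℂ]) := {y | ∃ p ∈ table, ev p = y}
    have hX : X.Finite := by
      refine Set.Finite.of_finite_image (f := Subtype.val) ?_ Subtype.val_injective.injOn
      refine ((table.toFinset.finite_toSet).image ev).subset ?_
      rintro _ ⟨y, ⟨p, hp, hpy⟩, rfl⟩
      exact ⟨p, by simpa using hp, hpy⟩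
    intro hx
    change x ∈ X
    induction hx using Subgroup.closure_induction_left with
    | one => exact ⟨table.getD 0 unit, by decide, ev_unit⟩
    | mul_left x hx y hy ih =>
      obtain ⟨j, rfl⟩ := hx
      exact hmul j y ih
    | inv_mul_cancel x hx y hy ih =>
      obtain ⟨j, rfl⟩ := hx
      -- Left multiplication by a generator is an injective self-map of the finite set X, hence
      -- onto; so X is also stable under the inverse generators.
      have himg : (unitRoot j * ·) '' X = X := Set.eq_of_subset_of_ncard_le
        (by rintro _ ⟨y, hy, rfl⟩; exact hmul j y hy)
        (Set.ncard_image_of_injective X (mul_right_injective (unitRoot j))).ge hX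
      change y ∈ X at ih
      rw [← himg] at ih
      obtain ⟨z, hz, hzy⟩ := ih
      rw [← hzy]
      simpa using hz
  · rintro ⟨p, hp, hpx⟩
    obtain ⟨i, hi, rfl⟩ := List.mem_iff_getElem.1 hp
    obtain ⟨y, hy, hye⟩ := table_subset_icosians i (table_length ▸ hi)
    rw [List.getD_eq_getElem _ _ hi, hpx] at hye
    rwa [← Subtype.ext hye]

/-- Icosians as entries of the table. -/
def icosiansEquiv : {p // p ∈ table} ≃ icosians :=
  Equiv.ofBijective (fun p => ⟨⟨ev p.1, ev_mem_unitary p.2⟩, mem_icosians_iff.2 ⟨_, p.2, rfl⟩⟩)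
    ⟨fun p q h => Subtype.ext (ev_injective (congrArg (fun x : icosians => x.1.1) h)),
      fun x => by
        obtain ⟨p, hp, hpx⟩ := mem_icosians_iff.1 x.2
        exact ⟨⟨p, hp⟩, Subtype.ext (Subtype.ext hpx)⟩⟩

instance : Fintype icosians := Fintype.ofEquiv _ icosiansEquiv

/-- The reduced trace of a unit quaternion. -/
def redTrace (x : unitary ℍ[ℂ]) : ℂ := 2 * (x : ℍ[ℂ]).re

lemma sum_icosians (F : ℂ → ℂ) : ∑ c : icosians, F (redTrace c) =
    F 2 + F (-2) + 30 * F 0 + 20 * F 1 + 20 * F (-1) + 12 * F phi + 12 * F (-phi)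
      + 12 * F (1 - phi) + 12 * F (phi - 1) := by
  have h1 : ∑ c : icosians, F (redTrace c)
      = ((table.map fun p => (p.x0, p.y0)).map fun t : ℤ × ℤ => F (t.1 + t.2 * phi)).sum := by
    rw [← icosiansEquiv.sum_comp, List.map_map, ← List.sum_toFinset _ table_nodup,
      ← Finset.sum_coe_sort table.toFinset]
    refine Fintype.sum_equiv (Equiv.subtypeEquivRight (by simp)) _ _ fun p => ?_
    have : redTrace (icosiansEquiv p).1 = p.1.x0 + p.1.y0 * phi := by
      change 2 * (ev p.1).re = _
      rw [re_ev]
      ring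
    rw [this]
    rfl
  rw [h1, (table_traces.map _).sum_eq]
  simp only [List.map_cons, List.map_append, List.map_replicate, List.sum_cons, List.sum_append,
    List.sum_replicate, nsmul_eq_mul]
  push_cast
  ring_nf

lemma redTrace_inv (x : unitary ℍ[ℂ]) : redTrace x⁻¹ = redTrace x := by
  simp [redTrace, ← Unitary.star_eq_inv]

/-- Take traces in x² = t x - 1, which holds for x of norm one and trace t. -/
lemma redTrace_sq (x : unitary ℍ[ℂ]) : redTrace (x * x) = redTrace x ^ 2 - 2 := by
  have h := congrArg QuaternionAlgebra.re (Unitary.coe_star_mul_self x)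
  simp only [redTrace, Submonoid.coe_mul, re_mul, re_star, imI_star, imJ_star, imK_star, re_one]
    at h ⊢
  linear_combination (-2) * h

lemma neg_one_mem_icosians : (-1 : unitary ℍ[ℂ]) ∈ icosians := by
  refine mem_icosians_iff.2 ⟨_, neg_unit_mem, ?_⟩
  ext <;> simp [Unitary.coe_neg]

lemma redTrace_eq_two_iff {x : unitary ℍ[ℂ]} (hx : x ∈ icosians) : redTrace x = 2 ↔ x = 1 := by
  have h1 : ∀ p ∈ table, p.x0 = 2 → p.y0 = 0 → p = unit := by decide +kernel
  obtain ⟨p, hp, hpx⟩ := mem_icosians_iff.1 hx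
  constructor
  · intro h
    have h2 : (p.x0 : ℂ) + p.y0 * phi = (2 : ℤ) + (0 : ℤ) * phi := by
      rw [redTrace, ← hpx, re_ev] at h
      push_cast
      linear_combination h
    obtain ⟨ha, hb⟩ := phi_lin_injective h2
    apply Subtype.ext
    rw [← hpx, h1 p hp ha hb, ev_unit]
    rfl
  · rintro rfl
    simp [redTrace]

lemma redTrace_neg (x : unitary ℍ[ℂ]) : redTrace (-x) = -redTrace x := by
  simp [redTrace, Unitary.coe_neg]

end IcosianGroup

end

/-! ### Traces and determinants of the maps x ↦ a x b̄ and x ↦ a x̄ b̄ -/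

noncomputable section

open Quaternion IcoCoord

section Rotations

/-- The quaternion with coordinates `a, b, c, d`. -/
def quatMk (a b c d : ℂ) : ℍ[ℂ] := ⟨a, b, c, d⟩

@[simp] lemma re_quatMk (a b c d : ℂ) : (quatMk a b c d).re = a := rfl

@[simp] lemma imI_quatMk (a b c d : ℂ) : (quatMk a b c d).imI = b := rfl

@[simp] lemma imJ_quatMk (a b c d : ℂ) : (quatMk a b c d).imJ = c := rfl

@[simp] lemma imK_quatMk (a b c d : ℂ) : (quatMk a b c d).imK = d := rfl

/-- The map `x ↦ a x b⋆` on quaternions, for unit quaternions `a` and `b`. -/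
def quatRot (a b : unitary ℍ[ℂ]) : ℍ[ℂ] ≃ₗ[ℂ] ℍ[ℂ] where
  toFun x := a * x * star (b : ℍ[ℂ])
  invFun x := star (a : ℍ[ℂ]) * x * b
  map_add' x y := by rw [mul_add, add_mul]
  map_smul' c x := by
    apply QuaternionAlgebra.ext <;> simp <;> ring
  left_inv x := by
    calc _ = (star (a : ℍ[ℂ]) * a) * x * (star (b : ℍ[ℂ]) * b) := by simp only [mul_assoc]
      _ = x := by rw [Unitary.coe_star_mul_self, Unitary.coe_star_mul_self, one_mul, mul_one]
  right_inv x := by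
    calc _ = (a * star (a : ℍ[ℂ])) * x * (b * star (b : ℍ[ℂ])) := by simp only [mul_assoc]
      _ = x := by rw [Unitary.mul_star_self_of_mem a.2, Unitary.mul_star_self_of_mem b.2, one_mul,
          mul_one]

lemma quatRot_apply (a b : unitary ℍ[ℂ]) (x : ℍ[ℂ]) :
    quatRot a b x = a * x * star (b : ℍ[ℂ]) := rfl

/-- Quaternion conjugation as a complex linear map. -/
def quatConj : ℍ[ℂ] ≃ₗ[ℂ] ℍ[ℂ] where
  toFun x := star x
  invFun x := star x
  map_add' x y := star_add x y
  map_smul' c x := by simp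
  left_inv x := star_star x
  right_inv x := star_star x

lemma quatConj_apply (x : ℍ[ℂ]) : quatConj x = star x := rfl

/-- The basis `1, i, j, k`. -/
def quatBasis : Module.Basis (Fin 4) ℂ ℍ[ℂ] := QuaternionAlgebra.basisOneIJK (-1 : ℂ) 0 (-1)

lemma quatBasis_repr (q : ℍ[ℂ]) : ⇑(quatBasis.repr q) = ![q.re, q.imI, q.imJ, q.imK] :=
  QuaternionAlgebra.coe_basisOneIJK_repr _ _ _ q

lemma quatBasis_zero : quatBasis 0 = quatMk 1 0 0 0 := by
  rw [← quatBasis.repr.injective.eq_iff, Module.Basis.repr_self]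
  refine DFunLike.ext _ _ fun i => ?_
  rw [quatBasis_repr]
  fin_cases i <;> simp

lemma quatBasis_one : quatBasis 1 = quatMk 0 1 0 0 := by
  rw [← quatBasis.repr.injective.eq_iff, Module.Basis.repr_self]
  refine DFunLike.ext _ _ fun i => ?_
  rw [quatBasis_repr]
  fin_cases i <;> simp

lemma quatBasis_two : quatBasis 2 = quatMk 0 0 1 0 := by
  rw [← quatBasis.repr.injective.eq_iff, Module.Basis.repr_self]
  refine DFunLike.ext _ _ fun i => ?_
  rw [quatBasis_repr]
  fin_cases i <;> simp

lemma quatBasis_three : quatBasis 3 = quatMk 0 0 0 1 := by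
  rw [← quatBasis.repr.injective.eq_iff, Module.Basis.repr_self]
  refine DFunLike.ext _ _ fun i => ?_
  rw [quatBasis_repr]
  fin_cases i <;> simp

lemma toMatrix_quatBasis (f : ℍ[ℂ] →ₗ[ℂ] ℍ[ℂ]) (i j : Fin 4) :
    LinearMap.toMatrix quatBasis quatBasis f i j = quatBasis.repr (f (quatBasis j)) i :=
  LinearMap.toMatrix_apply _ _ _ _ _

lemma trace_quat (f : ℍ[ℂ] →ₗ[ℂ] ℍ[ℂ]) : LinearMap.trace ℂ _ f =
    (f (quatMk 1 0 0 0)).re + (f (quatMk 0 1 0 0)).imI + (f (quatMk 0 0 1 0)).imJ + (f (quatMk 0 0 0 1)).imK := by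
  rw [LinearMap.trace_eq_matrix_trace ℂ quatBasis, Matrix.trace, Fin.sum_univ_four]
  simp only [Matrix.diag_apply, toMatrix_quatBasis, quatBasis_zero, quatBasis_one, quatBasis_two,
    quatBasis_three, quatBasis_repr]
  rfl

lemma trace_quatRot (a b : unitary ℍ[ℂ]) :
    LinearMap.trace ℂ _ (quatRot a b).toLinearMap = redTrace a * redTrace b := by
  rw [trace_quat]
  simp only [quatRot_apply, redTrace, LinearEquiv.coe_coe, re_mul, imI_mul, imJ_mul, imK_mul, re_star, imI_star, imJ_star, imK_star,
    re_quatMk, imI_quatMk, imJ_quatMk, imK_quatMk]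
  ring

/-- Write x̄ = t(x) - x. The map becomes x ↦ t(x) a b̄ - a x b̄, of trace t(a b̄) - t(a)t(b) =
-t(ab). -/
lemma trace_quatRot_quatConj (a b : unitary ℍ[ℂ]) :
    LinearMap.trace ℂ _ (quatRot a b * quatConj).toLinearMap = -redTrace (a * b) := by
  rw [trace_quat]
  simp only [quatRot_apply, quatConj_apply, redTrace, LinearEquiv.coe_coe, LinearEquiv.mul_apply, Submonoid.coe_mul,
    re_mul, imI_mul, imJ_mul, imK_mul, re_star, imI_star, imJ_star, imK_star,
    re_quatMk, imI_quatMk, imJ_quatMk, imK_quatMk]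
  ring

lemma normSq_unitary (a : unitary ℍ[ℂ]) : (a : ℍ[ℂ]).re ^ 2 + (a : ℍ[ℂ]).imI ^ 2 +
    (a : ℍ[ℂ]).imJ ^ 2 + (a : ℍ[ℂ]).imK ^ 2 = 1 := by
  have h := congrArg QuaternionAlgebra.re (Unitary.coe_star_mul_self a)
  simp only [re_mul, re_star, imI_star, imJ_star, imK_star, re_one] at h
  linear_combination h

lemma quatRot_mul (a b c d : unitary ℍ[ℂ]) :
    quatRot (a * c) (b * d) = quatRot a b * quatRot c d := by
  ext x : 1
  simp only [LinearEquiv.mul_apply, quatRot_apply, Submonoid.coe_mul, mul_assoc]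
  have h : star ((b : ℍ[ℂ]) * d) = star (d : ℍ[ℂ]) * star (b : ℍ[ℂ]) := star_mul _ _
  rw [h]

lemma quatConj_mul_self : quatConj * quatConj = 1 := by
  ext x : 1
  exact star_star x

lemma quatConj_mul_quatRot (a b : unitary ℍ[ℂ]) :
    quatConj * quatRot a b = quatRot b a * quatConj := by
  ext x : 1
  simp only [LinearEquiv.mul_apply, quatRot_apply, quatConj_apply, star_mul, star_star, mul_assoc]

lemma det_quat (f : ℍ[ℂ] →ₗ[ℂ] ℍ[ℂ]) : LinearMap.det f =
    Matrix.det (Matrix.of ![![(f (quatMk 1 0 0 0)).re, (f (quatMk 0 1 0 0)).re,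
        (f (quatMk 0 0 1 0)).re, (f (quatMk 0 0 0 1)).re],
      ![(f (quatMk 1 0 0 0)).imI, (f (quatMk 0 1 0 0)).imI, (f (quatMk 0 0 1 0)).imI,
        (f (quatMk 0 0 0 1)).imI],
      ![(f (quatMk 1 0 0 0)).imJ, (f (quatMk 0 1 0 0)).imJ, (f (quatMk 0 0 1 0)).imJ,
        (f (quatMk 0 0 0 1)).imJ],
      ![(f (quatMk 1 0 0 0)).imK, (f (quatMk 0 1 0 0)).imK, (f (quatMk 0 0 1 0)).imK,
        (f (quatMk 0 0 0 1)).imK]]) := by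
  rw [← LinearMap.det_toMatrix quatBasis]
  congr 1
  ext i j
  rw [toMatrix_quatBasis, quatBasis_repr]
  fin_cases j <;> simp only [Fin.zero_eta, Fin.mk_one, Fin.reduceFinMk, quatBasis_zero,
    quatBasis_one, quatBasis_two, quatBasis_three] <;> fin_cases i <;> rfl

/-- Left multiplication by a has determinant N(a)², where N is the norm form. -/
lemma det_quatRot_left (a : unitary ℍ[ℂ]) : LinearMap.det (quatRot a 1).toLinearMap = 1 := by
  have h := normSq_unitary a
  rw [det_quat]
  simp only [quatRot_apply, LinearEquiv.coe_coe, re_mul, imI_mul, imJ_mul, imK_mul, re_star, imI_star, imJ_star, imK_star,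
    OneMemClass.coe_one, re_one, imI_one, imJ_one, imK_one, re_quatMk, imI_quatMk, imJ_quatMk, imK_quatMk]
  simp only [Matrix.det_succ_row_zero, Fin.sum_univ_succ]
  simp [Fin.succAbove]
  generalize (a : ℍ[ℂ]).re = p, (a : ℍ[ℂ]).imI = q, (a : ℍ[ℂ]).imJ = r, (a : ℍ[ℂ]).imK = s at *
  linear_combination (p ^ 2 + q ^ 2 + r ^ 2 + s ^ 2 + 1) * h

lemma det_quatConj : LinearMap.det quatConj.toLinearMap = -1 := by
  rw [det_quat]
  simp only [quatConj_apply, LinearEquiv.coe_coe, re_star, imI_star, imJ_star, imK_star,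
    re_quatMk, imI_quatMk, imJ_quatMk, imK_quatMk]
  simp [Matrix.det_succ_row_zero, Fin.sum_univ_succ, Fin.succAbove]

lemma det_quatRot (a b : unitary ℍ[ℂ]) : LinearMap.det (quatRot a b).toLinearMap = 1 := by
  -- Quaternion conjugation turns left multiplication by b into right multiplication by b̄, which
  -- reduces the determinant to the case b = 1.
  have h1 : quatRot a b = quatRot a 1 * (quatConj * quatRot b 1 * quatConj) := by
    rw [quatConj_mul_quatRot, mul_assoc, quatConj_mul_self, mul_one, ← quatRot_mul]
    simp
  have h2 : (quatRot a b).toLinearMap = (quatRot a 1).toLinearMap ∘ₗ quatConj.toLinearMap ∘ₗ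
      (quatRot b 1).toLinearMap ∘ₗ quatConj.toLinearMap := by
    rw [h1]; rfl
  rw [h2, LinearMap.det_comp, LinearMap.det_comp, LinearMap.det_comp, det_quatRot_left,
    det_quatRot_left, det_quatConj]
  norm_num

end Rotations
end

/-! ### The reflections generate all rotations by icosians, and conjugation -/

noncomputable section

open Quaternion IcoCoord

section Generation

/-- The four simple roots of type `H₄` as unit quaternions. -/
def simpleRoot : Fin 4 → unitary ℍ[ℂ] := ![unitRoot 0, unitRoot 1, unitRoot 2, 1]

lemma unitRoot_mem (j : Fin 3) : unitRoot j ∈ icosians := Subgroup.subset_closure ⟨j, rfl⟩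

lemma simpleRoot_mem (i : Fin 4) : simpleRoot i ∈ icosians := by
  fin_cases i
  · exact unitRoot_mem 0
  · exact unitRoot_mem 1
  · exact unitRoot_mem 2
  · exact one_mem _

lemma neg_mem_icosians {a : unitary ℍ[ℂ]} (ha : a ∈ icosians) : -a ∈ icosians := by
  rw [← neg_one_mul]
  exact mul_mem neg_one_mem_icosians ha

variable {𝒢 : Type*} [Group 𝒢] (L : unitary ℍ[ℂ] × unitary ℍ[ℂ] →* 𝒢) (C : 𝒢)

/-- The subgroup generated by the reflections `x ↦ -r x⋆ r` in the simple roots. -/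
def reflectionSubgroup : Subgroup 𝒢 :=
  Subgroup.closure (Set.range fun i => L (-simpleRoot i, (simpleRoot i)⁻¹) * C)

variable {L C} (hC : C * C = 1) (hL : ∀ a b, C * L (a, b) = L (b, a) * C)

include hC hL in
lemma exists_of_mem_reflectionSubgroup {w : 𝒢} (hw : w ∈ reflectionSubgroup L C) :
    ∃ a ∈ icosians, ∃ b ∈ icosians, w = L (a, b) ∨ w = L (a, b) * C := by
  induction hw using Subgroup.closure_induction with
  | mem x hx =>
    obtain ⟨i, rfl⟩ := hx
    exact ⟨_, neg_mem_icosians (simpleRoot_mem i), _, inv_mem (simpleRoot_mem i), Or.inr rfl⟩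
  | one => exact ⟨1, one_mem _, 1, one_mem _, Or.inl (map_one L).symm⟩
  | mul x y _ _ ihx ihy =>
    obtain ⟨a, ha, b, hb, hx⟩ := ihx
    obtain ⟨c, hc, d, hd, hy⟩ := ihy
    rcases hx with rfl | rfl <;> rcases hy with rfl | rfl
    · exact ⟨_, mul_mem ha hc, _, mul_mem hb hd, Or.inl (map_mul L _ _).symm⟩
    · exact ⟨_, mul_mem ha hc, _, mul_mem hb hd, Or.inr (by
        rw [← mul_assoc, ← map_mul]; rfl)⟩
    · exact ⟨_, mul_mem ha hd, _, mul_mem hb hc, Or.inr (by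
        rw [mul_assoc, hL, ← mul_assoc, ← map_mul]; rfl)⟩
    · exact ⟨_, mul_mem ha hd, _, mul_mem hb hc, Or.inl (by
        rw [mul_assoc, ← mul_assoc C, hL, mul_assoc _ C, hC, mul_one, ← map_mul]; rfl)⟩
  | inv x _ ihx =>
    obtain ⟨a, ha, b, hb, hx⟩ := ihx
    have hCi : C⁻¹ = C := inv_eq_of_mul_eq_one_left hC
    rcases hx with rfl | rfl
    · exact ⟨_, inv_mem ha, _, inv_mem hb, Or.inl (map_inv L _).symm⟩
    · exact ⟨_, inv_mem hb, _, inv_mem ha, Or.inr (by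
        rw [mul_inv_rev, hCi, ← map_inv]; exact hL _ _)⟩

/-- The rotation is the reflection in the root r times the inverse of the reflection in 1. -/
lemma twisted_root_mem (j : Fin 3) :
    L (unitRoot j, (unitRoot j)⁻¹) ∈ reflectionSubgroup L C := by
  have h3 : L (-simpleRoot 3, (simpleRoot 3)⁻¹) * C ∈ reflectionSubgroup L C :=
    Subgroup.subset_closure ⟨3, rfl⟩
  have hj : L (-unitRoot j, (unitRoot j)⁻¹) * C ∈ reflectionSubgroup L C :=
    Subgroup.subset_closure ⟨j.castSucc, by fin_cases j <;> rfl⟩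
  have h := mul_mem hj (inv_mem h3)
  have hs : simpleRoot 3 = 1 := rfl
  rw [mul_inv_rev, mul_assoc, mul_inv_cancel_left, ← map_inv, ← map_mul, hs] at h
  convert h using 2
  ext <;> simp

/-- It suffices to treat a generator r. The word `commWord`, evaluated at the pairs (rᵢ, rᵢ⁻¹),
equals (r, 1): its first coordinate is r and its second collapses. -/
lemma left_mem_reflectionSubgroup {a : unitary ℍ[ℂ]} (ha : a ∈ icosians) :
    L (a, 1) ∈ reflectionSubgroup L C := by
  suffices h : icosians ≤ ((reflectionSubgroup L C).comap L).comap
      (MonoidHom.inl (unitary ℍ[ℂ]) (unitary ℍ[ℂ])) from h ha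
  rw [icosians, Subgroup.closure_le]
  rintro _ ⟨j, rfl⟩
  change L (unitRoot j, 1) ∈ reflectionSubgroup L C
  let k : Fin 3 × Bool → unitary ℍ[ℂ] × unitary ℍ[ℂ] := fun l =>
    if l.2 then (unitRoot l.1, (unitRoot l.1)⁻¹) else (unitRoot l.1, (unitRoot l.1)⁻¹)⁻¹
  have hk (l) : k l ∈ (reflectionSubgroup L C).comap L := by
    have := twisted_root_mem (L := L) (C := C) l.1
    by_cases hl : l.2
    · simpa [k, hl] using this
    · simpa only [k, hl, if_false, Bool.false_eq_true] using
        ((reflectionSubgroup L C).comap L).inv_mem this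
  have hprod : ((commWord j).map k).prod = (unitRoot j, 1) := by
    have key (g : Fin 3 × Bool → unitary ℍ[ℂ]) (f : Fin 3 × Bool → IcoCoord) (q : IcoCoord)
        (hq : checkWord f (commWord j) q = true) (hgf : ∀ l, (g l : ℍ[ℂ]) = ev (f l)) :
        ((((commWord j).map g).prod : unitary ℍ[ℂ]) : ℍ[ℂ]) = ev q := by
      rw [← ev_of_checkWord f _ q hq, ← Submonoid.coe_subtype, map_list_prod, List.map_map]
      simp only [Function.comp_def, Submonoid.coe_subtype, hgf]
    obtain ⟨h1, h2⟩ := checkWord_commWord j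
    have hf1 : ((commWord j).map k).prod.1 = unitRoot j := by
      rw [← MonoidHom.coe_fst, map_list_prod, List.map_map]
      apply Subtype.ext
      refine key _ letter _ h1 ?_
      rintro ⟨i, b⟩
      cases b
      · exact (ev_conj _).symm
      · rfl
    have hf2 : ((commWord j).map k).prod.2 = 1 := by
      rw [← MonoidHom.coe_snd, map_list_prod, List.map_map]
      apply Subtype.ext
      refine (key _ (fun l => conj (letter l)) _ h2 ?_).trans ev_unit
      rintro ⟨i, b⟩
      cases b
      · change star (star (ev (root i))) = ev (conj (conj (root i)))
        rw [ev_conj, ev_conj]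
      · exact (ev_conj _).symm
    exact Prod.ext hf1 hf2
  have := list_prod_mem (S := (reflectionSubgroup L C).comap L) (l := (commWord j).map k) (by
    intro x hx
    obtain ⟨l, -, rfl⟩ := List.mem_map.1 hx
    exact hk l)
  rwa [hprod] at this

/-- The reflection in the simple root 1 is L(-1, 1) C, and L(-1, 1) is already available. -/
lemma conj_mem_reflectionSubgroup : C ∈ reflectionSubgroup L C := by
  have h3 : L (-simpleRoot 3, (simpleRoot 3)⁻¹) * C ∈ reflectionSubgroup L C :=
    Subgroup.subset_closure ⟨3, rfl⟩
  have h := mul_mem (inv_mem (left_mem_reflectionSubgroup (L := L) (C := C) neg_one_mem_icosians)) h3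
  rwa [show (-simpleRoot 3, (simpleRoot 3)⁻¹) = (-1, 1) from by simp [simpleRoot],
    inv_mul_cancel_left] at h

include hC hL in
-- (1, b) is the C-conjugate of (b, 1).
lemma rot_mem_reflectionSubgroup {a b : unitary ℍ[ℂ]} (ha : a ∈ icosians) (hb : b ∈ icosians) :
    L (a, b) ∈ reflectionSubgroup L C := by
  have hCm := conj_mem_reflectionSubgroup (L := L) (C := C)
  have h1 := left_mem_reflectionSubgroup (L := L) (C := C) ha
  have h2 := mul_mem (mul_mem hCm (left_mem_reflectionSubgroup (L := L) (C := C) hb)) hCm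
  rw [hL, mul_assoc, hC, mul_one] at h2
  have := mul_mem h1 h2
  rwa [← map_mul, Prod.mk_mul_mk, mul_one, one_mul] at this

end Generation
end

/-! ### The geometric representation of type H₄ on quaternions -/

noncomputable section

open Quaternion IcoCoord

section Geometric

lemma coe_simpleRoot (i : Fin 4) :
    (simpleRoot i : ℍ[ℂ]) = ![quatMk 0 0 1 0, quatMk 0 (phi / 2) (-1 / 2) ((1 - phi) / 2),
      quatMk (-phi / 2) (-1 / 2) 0 ((phi - 1) / 2), quatMk 1 0 0 0] i := by
  fin_cases i <;> apply QuaternionAlgebra.ext <;> simp [simpleRoot, unitRoot, root] <;> ring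

lemma phi_sub_one_ne_zero : phi - 1 ≠ 0 := by
  intro h
  have h2 := phi_sq
  have : phi = 1 := by linear_combination h
  rw [this] at h2
  norm_num at h2

lemma linearIndependent_simpleRoot :
    LinearIndependent ℂ fun i => (simpleRoot i : ℍ[ℂ]) := by
  rw [Fintype.linearIndependent_iff]
  intro g hg
  rw [Fin.sum_univ_four] at hg
  simp only [coe_simpleRoot] at hg
  have h0 := congrArg QuaternionAlgebra.re hg
  have h1 := congrArg QuaternionAlgebra.imI hg
  have h2 := congrArg QuaternionAlgebra.imJ hg
  have h3 := congrArg QuaternionAlgebra.imK hg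
  simp at h0 h1 h2 h3
  have hp := phi_sub_one_ne_zero
  have e12 : g 1 = g 2 := by
    apply mul_right_cancel₀ hp
    linear_combination (-2) * h3
  have e1 : g 1 = 0 := by
    apply mul_right_cancel₀ hp
    rw [← e12] at h1
    linear_combination 2 * h1
  have e2 : g 2 = 0 := e12 ▸ e1
  rw [e1] at h2
  rw [e2] at h0
  simp at h0 h2
  intro i
  fin_cases i
  exacts [h2, e1, e2, h0]

/-- The basis of simple roots of the quaternions. -/
def rootBasis : Module.Basis (Fin 4) ℂ ℍ[ℂ] :=
  basisOfLinearIndependentOfCardEqFinrank linearIndependent_simpleRoot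
    (by rw [Quaternion.finrank_eq_four]; rfl)

lemma rootBasis_apply (i : Fin 4) : rootBasis i = simpleRoot i := by
  simp [rootBasis]

/-- The reflection in a unit quaternion `r` is `x ↦ -r x⋆ r`. -/
lemma quatRot_quatConj_eq_reflection (r : unitary ℍ[ℂ]) (x : ℍ[ℂ]) :
    (quatRot (-r) r⁻¹ * quatConj) x = x - (2 * ((r : ℍ[ℂ]) * star x).re) • (r : ℍ[ℂ]) := by
  have h := normSq_unitary r
  have hr : ((r⁻¹ : unitary ℍ[ℂ]) : ℍ[ℂ]) = star (r : ℍ[ℂ]) := rfl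
  have hn : ((-r : unitary ℍ[ℂ]) : ℍ[ℂ]) = -(r : ℍ[ℂ]) := rfl
  rw [LinearEquiv.mul_apply, quatRot_apply, quatConj_apply, hr, hn]
  generalize (r : ℍ[ℂ]) = q at *
  apply QuaternionAlgebra.ext
  · simp
    linear_combination x.re * h
  · simp
    linear_combination x.imI * h
  · simp
    linear_combination x.imJ * h
  · simp
    linear_combination x.imK * h

/-- The chosen icosians have the Gram matrix of the simple roots of H₄; the entry for the bond of
order 5 is 2cos(π/5) = φ up to sign. -/
lemma neg_two_mul_cos (i j : Fin 4) :
    ((-2 * Real.cos (Real.pi / CoxeterMatrix.H₄ i j) : ℝ) : ℂ)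
      = 2 * ((simpleRoot i : ℍ[ℂ]) * star (simpleRoot j : ℍ[ℂ])).re := by
  have h5 : ((-2 * Real.cos (Real.pi / (5 : ℕ)) : ℝ) : ℂ) = -phi := by
    rw [phi, ← Complex.ofReal_neg, Complex.ofReal_inj, Nat.cast_ofNat, Real.cos_pi_div_five,
      Real.goldenRatio]
    ring
  have h3 : ((-2 * Real.cos (Real.pi / (3 : ℕ)) : ℝ) : ℂ) = -1 := by
    simp
  have h2 : ((-2 * Real.cos (Real.pi / (2 : ℕ)) : ℝ) : ℂ) = 0 := by
    simp
  have h1 : ((-2 * Real.cos (Real.pi / (1 : ℕ)) : ℝ) : ℂ) = 2 := by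
    simp
  have hp := phi_sq
  simp only [coe_simpleRoot]
  have hM : CoxeterMatrix.H₄ i j
      = ![![1, 3, 2, 2], ![3, 1, 3, 2], ![2, 3, 1, 5], ![2, 2, 5, 1]] i j := by
    fin_cases i <;> fin_cases j <;> rfl
  rw [hM]
  fin_cases i <;> fin_cases j
  · exact h1.trans (by simp)
  · exact h3.trans (by simp; norm_num)
  · exact h2.trans (by simp)
  · exact h2.trans (by simp)
  · exact h3.trans (by simp; norm_num)
  · exact h1.trans (by simp; linear_combination (1 / 2) * hp)
  · exact h3.trans (by simp; linear_combination (1 / 2) * hp)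
  · exact h2.trans (by simp)
  · exact h2.trans (by simp)
  · exact h3.trans (by simp; linear_combination (1 / 2) * hp)
  · exact h1.trans (by simp; linear_combination (1 / 2) * hp)
  · exact h5.trans (by simp; ring)
  · exact h2.trans (by simp)
  · exact h2.trans (by simp)
  · exact h5.trans (by simp; ring)
  · exact h1.trans (by simp)

variable {V : Type} [AddCommGroup V] [Module ℂ V] (b : Module.Basis (Fin 4) ℂ V)

/-- The identification of `V` with the quaternions sending simple roots to simple roots. -/
def toQuat : V ≃ₗ[ℂ] ℍ[ℂ] := b.equiv rootBasis (Equiv.refl _)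

/-- Transport of automorphisms of the quaternions to `V`. -/
def transport : (ℍ[ℂ] ≃ₗ[ℂ] ℍ[ℂ]) →* (V ≃ₗ[ℂ] V) where
  toFun f := (toQuat b).trans (f.trans (toQuat b).symm)
  map_one' := by ext; simp
  map_mul' f g := by ext; simp

lemma toQuat_transport (f : ℍ[ℂ] ≃ₗ[ℂ] ℍ[ℂ]) (x : V) :
    toQuat b (transport b f x) = f (toQuat b x) := by
  simp [transport]

lemma transport_toLinearMap (f : ℍ[ℂ] ≃ₗ[ℂ] ℍ[ℂ]) :
    (transport b f).toLinearMap = (toQuat b).symm.conj f.toLinearMap := by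
  ext; simp [transport, LinearEquiv.conj_apply]

lemma trace_transport (f : ℍ[ℂ] ≃ₗ[ℂ] ℍ[ℂ]) :
    LinearMap.trace ℂ V (transport b f).toLinearMap = LinearMap.trace ℂ _ f.toLinearMap := by
  rw [transport_toLinearMap, LinearMap.trace_conj']

lemma det_transport (f : ℍ[ℂ] ≃ₗ[ℂ] ℍ[ℂ]) :
    LinearMap.det (transport b f).toLinearMap = LinearMap.det f.toLinearMap := by
  rw [transport_toLinearMap, LinearEquiv.conj_apply]
  exact LinearMap.det_conj f.toLinearMap (toQuat b).symm

/-- The action of pairs of unit quaternions on `V`. -/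
def rotHom : unitary ℍ[ℂ] × unitary ℍ[ℂ] →* (V ≃ₗ[ℂ] V) :=
  (transport b).comp
    { toFun p := quatRot p.1 p.2
      map_one' := by ext x : 1; simp [quatRot_apply]
      map_mul' p q := quatRot_mul _ _ _ _ }

/-- Quaternion conjugation on `V`. -/
def conjOn : V ≃ₗ[ℂ] V := transport b quatConj

lemma conjOn_mul_self : conjOn b * conjOn b = 1 := by
  rw [conjOn, ← map_mul, quatConj_mul_self, map_one]

lemma conjOn_mul_rotHom (p q : unitary ℍ[ℂ]) :
    conjOn b * rotHom b (p, q) = rotHom b (q, p) * conjOn b := by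
  change transport b quatConj * transport b (quatRot p q)
    = transport b (quatRot q p) * transport b quatConj
  rw [← map_mul, quatConj_mul_quatRot, map_mul]

lemma rotHom_neg_one : rotHom b (-1, -1) = 1 := by
  have : quatRot (-1) (-1) = 1 := by
    ext x : 1
    have hn : ((-1 : unitary ℍ[ℂ]) : ℍ[ℂ]) = -1 := rfl
    rw [quatRot_apply, hn]
    apply QuaternionAlgebra.ext <;> simp
  change transport b (quatRot (-1) (-1)) = 1
  rw [this, map_one]

/-- Both sides are reflections given by the same Gram matrix, so they agree on the basis of simple
roots. -/
lemma simpleReflection_eq (i : Fin 4) : simpleReflection CoxeterMatrix.H₄ b i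
    = rotHom b (-simpleRoot i, (simpleRoot i)⁻¹) * conjOn b := by
  change _ = transport b (quatRot (-simpleRoot i) (simpleRoot i)⁻¹) * transport b quatConj
  rw [← map_mul]
  apply LinearEquiv.toLinearMap_injective
  refine b.ext fun j => (toQuat b).injective ?_
  have hb (k) : toQuat b (b k) = simpleRoot k := by
    simp [toQuat, rootBasis_apply]
  simp only [LinearEquiv.coe_coe]
  rw [toQuat_transport, quatRot_quatConj_eq_reflection, simpleReflection,
    Module.reflection_apply, map_sub, map_smul, hb, hb, ← neg_two_mul_cos]
  simp [simpleCoroot]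

lemma closure_simpleReflection :
    Subgroup.closure (Set.range (simpleReflection CoxeterMatrix.H₄ b))
      = reflectionSubgroup (rotHom b) (conjOn b) := by
  rw [reflectionSubgroup]
  congr 2
  exact funext (simpleReflection_eq b)

lemma trace_rotHom (p q : unitary ℍ[ℂ]) :
    LinearMap.trace ℂ V (rotHom b (p, q)).toLinearMap = redTrace p * redTrace q :=
  (trace_transport b _).trans (trace_quatRot p q)

lemma trace_rotHom_mul_conjOn (p q : unitary ℍ[ℂ]) :
    LinearMap.trace ℂ V (rotHom b (p, q) * conjOn b).toLinearMap = -redTrace (p * q) := by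
  change LinearMap.trace ℂ V (transport b (quatRot p q) * transport b quatConj).toLinearMap = _
  rw [← map_mul, trace_transport, trace_quatRot_quatConj]

lemma det_rotHom (p q : unitary ℍ[ℂ]) : LinearMap.det (rotHom b (p, q)).toLinearMap = 1 :=
  (det_transport b _).trans (det_quatRot p q)

lemma det_conjOn : LinearMap.det (conjOn b).toLinearMap = -1 :=
  (det_transport b _).trans det_quatConj

end Geometric
end

/-! ### Calculus of tensor-square and induced characters -/

noncomputable section

open Quaternion IcoCoord

section WreathCharacters

variable {G : Type} [Group G] {L : icosians × icosians →* G} {C : G}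

/-- Average over the two cosets of rotations. -/
lemma average_eq [Fintype G] (hC : C * C = 1) (hL : ∀ p, C * L p = L p.swap * C)
    (hsurj : ∀ g, ∃ p, g = L p ∨ g = L p * C) (F : G → ℂ) :
    (Nat.card G : ℂ)⁻¹ * ∑ g, F g
      = (2 * (Fintype.card icosians : ℂ) ^ 2)⁻¹ * ∑ p, (F (L p) + F (L p * C)) := by
  let S (F : G → ℂ) : ℂ := ∑ p, (F (L p) + F (L p * C))
  -- S is invariant under left translation. Summing S over all translates of F in two orders gives
  -- the formula without determining the kernel of L or the order of G.
  have hinv (g : G) : S (fun x => F (g * x)) = S F := by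
    obtain ⟨q, rfl | rfl⟩ := hsurj g
    · refine Fintype.sum_equiv (Equiv.mulLeft q) _ _ fun p => ?_
      simp [mul_assoc]
    · refine Fintype.sum_equiv ((Equiv.prodComm _ _).trans (Equiv.mulLeft q)) _ _ fun p => ?_
      have h1 : L q * C * L p = L (q * p.swap) * C := by
        rw [mul_assoc, hL, ← mul_assoc, ← map_mul]
      have h2 : L q * C * (L p * C) = L (q * p.swap) := by
        rw [← mul_assoc, h1, mul_assoc, hC, mul_one]
      simp only [h1, h2]
      exact add_comm _ _
  have h1 : ∑ g, S (fun x => F (g * x)) = Nat.card G * S F := by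
    simp [hinv, Nat.card_eq_fintype_card]
  have h2 : ∑ g, S (fun x => F (g * x))
      = (2 * (Fintype.card icosians : ℂ) ^ 2) * ∑ g, F g := by
    rw [Finset.sum_comm]
    have (p : icosians × icosians) :
        ∑ g, (F (g * L p) + F (g * (L p * C))) = 2 * ∑ g, F g := by
      rw [Finset.sum_add_distrib, two_mul]
      exact congrArg₂ (· + ·) (Equiv.sum_comp (Equiv.mulRight (L p)) F)
        (Equiv.sum_comp (Equiv.mulRight (L p * C)) F)
    rw [Finset.sum_congr rfl fun p _ => this p, Finset.sum_const, Finset.card_univ,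
      Fintype.card_prod, nsmul_eq_mul]
    push_cast
    ring
  have hG : (Nat.card G : ℂ) ≠ 0 := by simp
  have hT : (2 * (Fintype.card icosians : ℂ) ^ 2) ≠ 0 :=
    mul_ne_zero two_ne_zero (pow_ne_zero 2 (Nat.cast_ne_zero.2 Fintype.card_ne_zero))
  rw [h2] at h1
  rw [inv_mul_eq_iff_eq_mul₀ hG, mul_left_comm, ← h1, inv_mul_cancel_left₀ hT]

/-- The sum over the icosians of a function of the reduced trace. -/
def icoSum (P : ℂ → ℂ) : ℂ := ∑ c : icosians, P (redTrace c)

lemma card_icosians : (Fintype.card icosians : ℂ) = 120 := by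
  have h := sum_icosians fun _ => 1
  rw [Finset.sum_const, Finset.card_univ, nsmul_eq_mul, mul_one] at h
  exact h.trans (by norm_num)

lemma sum_prod_icosians (P Q : ℂ → ℂ) :
    ∑ p : icosians × icosians, P (redTrace p.1) * Q (redTrace p.2) = icoSum P * icoSum Q := by
  rw [icoSum, icoSum, Finset.sum_mul_sum, Fintype.sum_prod_type]

lemma sum_mul_icosians (P : ℂ → ℂ) :
    ∑ p : icosians × icosians, P (redTrace ((p.1 : unitary ℍ[ℂ]) * p.2)) = 120 * icoSum P := by
  rw [Fintype.sum_prod_type]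
  have (a : icosians) : ∑ b : icosians, P (redTrace ((a : unitary ℍ[ℂ]) * b)) = icoSum P :=
    Equiv.sum_comp (Equiv.mulLeft a) fun c : icosians => P (redTrace c)
  rw [Finset.sum_congr rfl fun a _ => this a, Finset.sum_const, Finset.card_univ, nsmul_eq_mul,
    card_icosians]

variable (L C) in
/-- `x` has the character of the tensor square of a class function `P` of the reduced trace,
twisted by the sign `σ` on the nontrivial coset. -/
def IsTensorSquare (σ : ℂ) (P : ℂ → ℂ) (x : RepRing G) : Prop :=
  ∀ p : icosians × icosians,
    RepRing.charHom G x (L p) = P (redTrace p.1) * P (redTrace p.2) ∧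
    RepRing.charHom G x (L p * C) = σ * P (redTrace ((p.1 : unitary ℍ[ℂ]) * p.2))

variable (L C) in
/-- `x` has the character induced from the outer product of two class functions. -/
def IsInduced (P Q : ℂ → ℂ) (x : RepRing G) : Prop :=
  ∀ p : icosians × icosians,
    RepRing.charHom G x (L p)
      = P (redTrace p.1) * Q (redTrace p.2) + Q (redTrace p.1) * P (redTrace p.2) ∧
    RepRing.charHom G x (L p * C) = 0

section Pairing

variable (hC : C * C = 1) (hL : ∀ p, C * L p = L p.swap * C)
    (hsurj : ∀ g, ∃ p, g = L p ∨ g = L p * C)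

include hC hL in
lemma inv_mul_conj (p : icosians × icosians) : (L p * C)⁻¹ = L p⁻¹.swap * C := by
  rw [mul_inv_rev, inv_eq_of_mul_eq_one_left hC, ← map_inv, hL]

include hC hL hsurj in
-- Each of the two cosets contributes 1/2. Traces are invariant under inversion, so P * P appears
-- with no conjugate.
lemma pairing_self_of_isTensorSquare [Finite G] {σ : ℂ} (hσ : σ ^ 2 = 1) {P : ℂ → ℂ} {x : RepRing G}
    (hx : IsTensorSquare L C σ P x) (hP : icoSum (P * P) = 120) : RepRing.pairing x x = 1 := by
  have := Fintype.ofFinite G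
  rw [RepRing.pairing_eq, average_eq hC hL hsurj, Finset.sum_add_distrib, card_icosians]
  have h1 (p : icosians × icosians) : RepRing.charHom G x (L p) * RepRing.charHom G x (L p)⁻¹
      = (P * P) (redTrace p.1) * (P * P) (redTrace p.2) := by
    rw [← map_inv, (hx _).1, (hx _).1]
    simp only [Prod.fst_inv, Prod.snd_inv, Subgroup.coe_inv, redTrace_inv, Pi.mul_apply]
    ring
  have h2 (p : icosians × icosians) :
      RepRing.charHom G x (L p * C) * RepRing.charHom G x (L p * C)⁻¹
        = (P * P) (redTrace ((p.1 : unitary ℍ[ℂ]) * p.2)) := by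
    rw [inv_mul_conj hC hL, (hx _).2, (hx _).2]
    simp only [Prod.fst_swap, Prod.snd_swap, Prod.fst_inv, Prod.snd_inv, Subgroup.coe_inv,
      ← mul_inv_rev, redTrace_inv, Pi.mul_apply]
    linear_combination P (redTrace (p.1 * p.2)) ^ 2 * hσ
  simp only [h1, h2, sum_prod_icosians, sum_mul_icosians, hP]
  norm_num

include hC hL hsurj in
lemma pairing_self_of_isInduced [Finite G] {P Q : ℂ → ℂ} {x : RepRing G}
    (hx : IsInduced L C P Q x) (hP : icoSum (P * P) = 120) (hQ : icoSum (Q * Q) = 120)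
    (hPQ : icoSum (P * Q) = 0) : RepRing.pairing x x = 1 := by
  have := Fintype.ofFinite G
  rw [RepRing.pairing_eq, average_eq hC hL hsurj, Finset.sum_add_distrib, card_icosians]
  have h1 (p : icosians × icosians) : RepRing.charHom G x (L p) * RepRing.charHom G x (L p)⁻¹
      = (P * P) (redTrace p.1) * (Q * Q) (redTrace p.2)
        + (Q * Q) (redTrace p.1) * (P * P) (redTrace p.2)
        + ((P * Q) (redTrace p.1) * (P * Q) (redTrace p.2)
        + (P * Q) (redTrace p.1) * (P * Q) (redTrace p.2)) := by
    rw [← map_inv, (hx _).1, (hx _).1]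
    simp only [Prod.fst_inv, Prod.snd_inv, Subgroup.coe_inv, redTrace_inv, Pi.mul_apply]
    ring
  have h2 (p : icosians × icosians) :
      RepRing.charHom G x (L p * C) * RepRing.charHom G x (L p * C)⁻¹ = 0 := by
    rw [(hx _).2, zero_mul]
  simp only [h1, h2, Finset.sum_add_distrib, sum_prod_icosians, hP, hQ, hPQ, Finset.sum_const_zero]
  norm_num

end Pairing

lemma IsTensorSquare.mul {σ τ : ℂ} {P Q : ℂ → ℂ} {x y : RepRing G} (hx : IsTensorSquare L C σ P x)
    (hy : IsTensorSquare L C τ Q y) : IsTensorSquare L C (σ * τ) (P * Q) (x * y) := fun p => by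
  simp only [map_mul, Pi.mul_apply, (hx p).1, (hx p).2, (hy p).1, (hy p).2]
  constructor <;> ring

lemma IsTensorSquare.mul_isInduced {σ : ℂ} {P Q R : ℂ → ℂ} {x y : RepRing G}
    (hx : IsTensorSquare L C σ P x) (hy : IsInduced L C Q R y) :
    IsInduced L C (P * Q) (P * R) (x * y) := fun p => by
  simp only [map_mul, Pi.mul_apply, (hx p).1, (hx p).2, (hy p).1, (hy p).2]
  constructor <;> ring

lemma IsTensorSquare.add {σ : ℂ} {P Q : ℂ → ℂ} {x y z : RepRing G}
    (hx : IsTensorSquare L C σ P x) (hy : IsTensorSquare L C σ Q y) (hz : IsInduced L C P Q z) :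
    IsTensorSquare L C σ (P + Q) (x + y + z) := fun p => by
  simp only [map_add, Pi.add_apply, (hx p).1, (hx p).2, (hy p).1, (hy p).2, (hz p).1, (hz p).2]
  constructor <;> ring

lemma IsInduced.add {P Q R : ℂ → ℂ} {x y : RepRing G} (hx : IsInduced L C P R x)
    (hy : IsInduced L C Q R y) : IsInduced L C (P + Q) R (x + y) := fun p => by
  simp only [map_add, Pi.add_apply, (hx p).1, (hx p).2, (hy p).1, (hy p).2]
  constructor <;> ring

lemma IsInduced.sub {P Q R : ℂ → ℂ} {x y : RepRing G} (hx : IsInduced L C P R x)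
    (hy : IsInduced L C Q R y) : IsInduced L C (P - Q) R (x - y) := fun p => by
  simp only [map_sub, Pi.sub_apply, (hx p).1, (hx p).2, (hy p).1, (hy p).2]
  constructor <;> ring

lemma IsInduced.symm {P Q : ℂ → ℂ} {x : RepRing G} (hx : IsInduced L C P Q x) :
    IsInduced L C Q P x := fun p => ⟨by rw [(hx p).1, add_comm], (hx p).2⟩

/-- The representation induced from P ⊠ P splits into the two extensions of P ⊠ P, which differ by
the sign. -/
lemma isInduced_self {P : ℂ → ℂ} {x y : RepRing G} (hx : IsTensorSquare L C 1 P x)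
    (hy : IsTensorSquare L C (-1) P y) : IsInduced L C P P (x + y) := fun p => by
  simp only [map_add, Pi.add_apply, (hx p).1, (hx p).2, (hy p).1, (hy p).2]
  exact ⟨trivial, by ring⟩

/-- Products of induced characters. -/
lemma IsInduced.mul_sub {P Q : ℂ → ℂ} {x y z : RepRing G} (hx : IsInduced L C P 1 x)
    (hy : IsInduced L C Q 1 y) (hz : IsInduced L C P Q z) :
    IsInduced L C (P * Q) 1 (x * y - z) := fun p => by
  simp only [map_sub, map_mul, Pi.sub_apply, Pi.mul_apply, Pi.one_apply, (hx p).1, (hx p).2,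
    (hy p).1, (hy p).2, (hz p).1, (hz p).2]
  constructor <;> ring

/-- Integral polynomial functions all of whose exponents are congruent to `s` mod `2`. -/
def parityFunctions (s : ℕ) : AddSubgroup (ℂ → ℂ) :=
  AddSubgroup.closure (Set.range fun k : ℕ => (id ^ (2 * k + s) : ℂ → ℂ))

section Generation

variable (A : Subring (RepRing G)) {e : RepRing G} (he : e ∈ A) (he' : IsTensorSquare L C (-1) 1 e)
  (hid : ∃ x ∈ A, IsTensorSquare L C 1 id x) (hind : ∃ x ∈ A, IsInduced L C (id ^ 2 - 1) 1 x)

lemma isTensorSquare_one : IsTensorSquare L C 1 1 1 := fun p => by simp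

include hid in
lemma exists_isTensorSquare_pow (k : ℕ) : ∃ x ∈ A, IsTensorSquare L C 1 (id ^ k) x := by
  obtain ⟨x, hx, hx'⟩ := hid
  induction k with
  | zero => exact ⟨1, one_mem A, by simpa using isTensorSquare_one⟩
  | succ k ih =>
    obtain ⟨y, hy, hy'⟩ := ih
    exact ⟨y * x, mul_mem hy hx, by simpa [pow_succ] using hy'.mul hx'⟩

include he he' hid hind in
lemma exists_isInduced_even (m : ℕ) : ∃ x ∈ A, IsInduced L C (id ^ (2 * m)) 1 x := by
  have h0 : ∃ x ∈ A, IsInduced L C 1 1 x := ⟨_, add_mem (one_mem A) he, isInduced_self isTensorSquare_one he'⟩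
  have h2 : ∃ x ∈ A, IsInduced L C (id ^ 2) 1 x := by
    obtain ⟨x, hx, hx'⟩ := h0
    obtain ⟨y, hy, hy'⟩ := hind
    exact ⟨_, add_mem hy hx, by simpa using hy'.add hx'⟩
  induction m using Nat.twoStepInduction with
  | zero => simpa using h0
  | one => simpa using h2
  | more m ih1 ih2 =>
    obtain ⟨x, hx, hx'⟩ := ih2
    obtain ⟨y, hy, hy'⟩ := h2
    obtain ⟨z, hz, hz'⟩ := ih1
    obtain ⟨w, hw, hw'⟩ := exists_isTensorSquare_pow A hid 2
    -- Ind(t^(2m+2), 1) Ind(t², 1) = Ind(t^(2m+4), 1) + Ind(t^(2m+2), t²), and the last term is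
    -- T(t²) Ind(t^(2m), 1).
    refine ⟨x * y - w * z, sub_mem (mul_mem hx hy) (mul_mem hw hz), ?_⟩
    have h := hw'.mul_isInduced hz'
    rw [mul_one, ← pow_add, show 2 + 2 * m = 2 * (m + 1) by ring] at h
    have := hx'.mul_sub hy' h
    rwa [← pow_add, show 2 * (m + 1) + 2 = 2 * (m + 2) by ring] at this

include he he' hid hind in
-- With l ≤ k, factor out T(t^(2l+s)); what remains is Ind(t^(2(k-l)), 1). Equal parity makes the
-- remaining exponent even.
lemma exists_isInduced_pow (s k l : ℕ) :
    ∃ x ∈ A, IsInduced L C (id ^ (2 * k + s)) (id ^ (2 * l + s)) x := by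
  wlog h : l ≤ k generalizing k l
  · obtain ⟨x, hx, hx'⟩ := this l k (by omega)
    exact ⟨x, hx, hx'.symm⟩
  obtain ⟨m, rfl⟩ := Nat.exists_eq_add_of_le h
  obtain ⟨x, hx, hx'⟩ := exists_isInduced_even A he he' hid hind m
  obtain ⟨y, hy, hy'⟩ := exists_isTensorSquare_pow A hid (2 * l + s)
  refine ⟨y * x, mul_mem hy hx, ?_⟩
  have := hy'.mul_isInduced hx'
  rwa [mul_one, ← pow_add, show 2 * l + s + 2 * m = 2 * (l + m) + s by ring] at this

lemma isInduced_zero (Q : ℂ → ℂ) : IsInduced L C 0 Q 0 := fun p => by simp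

include he he' hid hind in
lemma exists_isInduced {s : ℕ} {P Q : ℂ → ℂ} (hP : P ∈ parityFunctions s)
    (hQ : Q ∈ parityFunctions s) : ∃ x ∈ A, IsInduced L C P Q x := by
  -- Additivity in one argument; by symmetry it is applied to each argument in turn.
  have key (B : Set (ℂ → ℂ)) (R : ℂ → ℂ) (hB : ∀ P ∈ B, ∃ x ∈ A, IsInduced L C P R x)
      (P : ℂ → ℂ) (hP : P ∈ AddSubgroup.closure B) : ∃ x ∈ A, IsInduced L C P R x := by
    induction hP using AddSubgroup.closure_induction with
    | mem P hP => exact hB P hP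
    | zero => exact ⟨0, zero_mem A, isInduced_zero R⟩
    | add P Q _ _ ihP ihQ =>
      obtain ⟨x, hx, hx'⟩ := ihP
      obtain ⟨y, hy, hy'⟩ := ihQ
      exact ⟨_, add_mem hx hy, hx'.add hy'⟩
    | neg P _ ihP =>
      obtain ⟨x, hx, hx'⟩ := ihP
      exact ⟨_, sub_mem (zero_mem A) hx, by simpa using (isInduced_zero R).sub hx'⟩
  refine key _ Q ?_ P hP
  rintro _ ⟨k, rfl⟩
  obtain ⟨x, hx, hx'⟩ := key _ (id ^ (2 * k + s)) (by
    rintro _ ⟨l, rfl⟩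
    exact exists_isInduced_pow A he he' hid hind s l k) Q hQ
  exact ⟨x, hx, hx'.symm⟩

include he he' hid hind in
lemma exists_isTensorSquare {s : ℕ} {P : ℂ → ℂ} (hP : P ∈ parityFunctions s) :
    ∃ x ∈ A, IsTensorSquare L C 1 P x := by
  unfold parityFunctions at hP
  induction hP using AddSubgroup.closure_induction with
  | mem P hP =>
    obtain ⟨k, rfl⟩ := hP
    exact exists_isTensorSquare_pow A hid _
  | zero => exact ⟨0, zero_mem A, fun p => by simp⟩
  | add P Q hP hQ ihP ihQ =>
    obtain ⟨x, hx, hx'⟩ := ihP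
    obtain ⟨y, hy, hy'⟩ := ihQ
    obtain ⟨z, hz, hz'⟩ := exists_isInduced A he he' hid hind hP hQ
    exact ⟨_, add_mem (add_mem hx hy) hz, hx'.add hy' hz'⟩
  | neg P _ ihP =>
    obtain ⟨x, hx, hx'⟩ := ihP
    -- P enters quadratically on rotations and linearly on the other coset, so replacing P by -P is
    -- the twist by the sign.
    refine ⟨e * x, mul_mem he hx, fun p => ?_⟩
    obtain ⟨h1, h2⟩ := he'.mul hx' p
    exact ⟨by simpa using h1, by simpa using h2⟩

end Generation

end WreathCharacters
end

/-! ### The character table of the binary icosahedral group -/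

noncomputable section

open Quaternion IcoCoord

section IcosianCharacters

lemma redTrace_mem {x : unitary ℍ[ℂ]} (hx : x ∈ icosians) : redTrace x = 2 ∨ redTrace x = -2 ∨
    redTrace x ∈ ({0, 1, -1, phi, -phi, 1 - phi, phi - 1} : Set ℂ) := by
  classical
  set T : Set ℂ := {0, 1, -1, phi, -phi, 1 - phi, phi - 1} with hT
  -- Count the icosians with any other trace: the sum formula gives zero.
  have h := sum_icosians fun t => if ¬(t = 2 ∨ t = -2 ∨ t ∈ T) then 1 else 0
  rw [if_neg (by simp), if_neg (by simp), if_neg (by simp [hT]), if_neg (by simp [hT]),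
    if_neg (by simp [hT]), if_neg (by simp [hT]), if_neg (by simp [hT]), if_neg (by simp [hT]),
    if_neg (by simp [hT])] at h
  rw [Finset.sum_boole] at h
  have h0 : Finset.card _ = 0 := Nat.cast_eq_zero.1 (h.trans (by norm_num))
  by_contra hne
  exact Finset.notMem_empty (⟨x, hx⟩ : icosians)
    (Finset.card_eq_zero.1 h0 ▸ Finset.mem_filter.2 ⟨Finset.mem_univ _, hne⟩)

/-- The irreducible characters of the icosians that are trivial on `-1`, as functions of the
reduced trace. -/
def evenCharacter : Fin 5 → ℂ → ℂ :=
  ![1, id ^ 2 - 1, id ^ 4 - 3 * id ^ 2 + 1, id ^ 8 - 7 * id ^ 6 + 14 * id ^ 4 - 7 * id ^ 2,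
    -id ^ 8 + 8 * id ^ 6 - 19 * id ^ 4 + 13 * id ^ 2 - 1]

/-- The irreducible characters of the icosians that are not trivial on `-1`, as functions of the
reduced trace. -/
def oddCharacter : Fin 4 → ℂ → ℂ :=
  ![id, id ^ 3 - 2 * id, id ^ 5 - 4 * id ^ 3 + 3 * id, id ^ 7 - 7 * id ^ 5 + 14 * id ^ 3 - 7 * id]

lemma pow_mem_parityFunctions (s k : ℕ) : (id ^ (2 * k + s) : ℂ → ℂ) ∈ parityFunctions s :=
  AddSubgroup.subset_closure ⟨k, rfl⟩

/-- The polynomials are Sym⁰, Sym², Sym⁴ of the two-dimensional representation, then t times its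
Galois conjugate (degree 4), then Sym⁶ minus that character, the second one of degree 3. -/
lemma evenCharacter_mem (i : Fin 5) : evenCharacter i ∈ parityFunctions 0 := by
  have h0 : (1 : ℂ → ℂ) ∈ parityFunctions 0 := pow_mem_parityFunctions 0 0
  have h1 := pow_mem_parityFunctions 0 1
  have h2 := pow_mem_parityFunctions 0 2
  have h3 := pow_mem_parityFunctions 0 3
  have h4 := pow_mem_parityFunctions 0 4
  have hz (n : ℤ) {f : ℂ → ℂ} (hf : f ∈ parityFunctions 0) : n * f ∈ parityFunctions 0 := by
    simpa using zsmul_mem hf n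
  fin_cases i
  · exact h0
  · exact sub_mem h1 h0
  · exact add_mem (sub_mem h2 (hz 3 h1)) h0
  · exact sub_mem (add_mem (sub_mem h4 (hz 7 h3)) (hz 14 h2)) (hz 7 h1)
  · exact sub_mem (add_mem (sub_mem (add_mem (neg_mem h4) (hz 8 h3)) (hz 19 h2)) (hz 13 h1)) h0

/-- The polynomials are Sym¹, Sym³, Sym⁵ and the trace of the seventh power; as 7 ≡ 2 mod 5, the
latter exchanges φ and 1 - φ while fixing the rational traces. -/
lemma oddCharacter_mem (i : Fin 4) : oddCharacter i ∈ parityFunctions 1 := by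
  have h0 : (id : ℂ → ℂ) ∈ parityFunctions 1 := by simpa using pow_mem_parityFunctions 1 0
  have h1 := pow_mem_parityFunctions 1 1
  have h2 := pow_mem_parityFunctions 1 2
  have h3 := pow_mem_parityFunctions 1 3
  have hz (n : ℤ) {f : ℂ → ℂ} (hf : f ∈ parityFunctions 1) : n * f ∈ parityFunctions 1 := by
    simpa using zsmul_mem hf n
  fin_cases i
  · exact h0
  · exact sub_mem h1 (hz 2 h0)
  · exact add_mem (sub_mem h2 (hz 4 h1)) (hz 3 h0)
  · exact sub_mem (add_mem (sub_mem h3 (hz 7 h2)) (hz 14 h1)) (hz 7 h0)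

lemma evenCharacter_neg (i : Fin 5) (t : ℂ) : evenCharacter i (-t) = evenCharacter i t := by
  fin_cases i <;> simp [evenCharacter] <;> ring

lemma oddCharacter_neg (i : Fin 4) (t : ℂ) : oddCharacter i (-t) = -oddCharacter i t := by
  fin_cases i <;> simp [oddCharacter] <;> ring

lemma evenCharacter_two (i : Fin 5) : evenCharacter i 2 = ![1, 3, 5, 4, 3] i := by
  fin_cases i <;> simp [evenCharacter] <;> norm_num

lemma evenCharacter_zero (i : Fin 5) : evenCharacter i 0 = ![1, -1, 1, 0, -1] i := by
  fin_cases i <;> simp [evenCharacter]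

lemma evenCharacter_one (i : Fin 5) : evenCharacter i 1 = ![1, 0, -1, 1, 0] i := by
  fin_cases i <;> simp [evenCharacter] <;> norm_num

/-- Stated for either root of x² = x + 1, so that φ and its conjugate 1 - φ are treated together. -/
lemma evenCharacter_of_sq {x : ℂ} (hx : x ^ 2 = x + 1) (i : Fin 5) :
    evenCharacter i x = ![1, x, 0, -1, 1 - x] i := by
  have h4 : x ^ 4 = 3 * x + 2 := by linear_combination (x ^ 2 + x + 2) * hx
  have h6 : x ^ 6 = 8 * x + 5 := by linear_combination x ^ 2 * h4 + 3 * x * hx + 5 * hx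
  have h8 : x ^ 8 = 21 * x + 13 := by linear_combination x ^ 2 * h6 + 8 * x * hx + 13 * hx
  fin_cases i <;> simp [evenCharacter, hx, h4, h6, h8] <;> ring

lemma oddCharacter_two (i : Fin 4) : oddCharacter i 2 = ![2, 4, 6, 2] i := by
  fin_cases i <;> simp [oddCharacter] <;> norm_num

lemma oddCharacter_zero (i : Fin 4) : oddCharacter i 0 = 0 := by
  fin_cases i <;> simp [oddCharacter]

lemma oddCharacter_one (i : Fin 4) : oddCharacter i 1 = ![1, -1, 0, 1] i := by
  fin_cases i <;> simp [oddCharacter] <;> norm_num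

lemma oddCharacter_of_sq {x : ℂ} (hx : x ^ 2 = x + 1) (i : Fin 4) :
    oddCharacter i x = ![x, 1, -1, 1 - x] i := by
  have h3 : x ^ 3 = 2 * x + 1 := by linear_combination (x + 1) * hx
  have h5 : x ^ 5 = 5 * x + 3 := by linear_combination x ^ 2 * h3 + 2 * x * hx + 3 * hx
  have h7 : x ^ 7 = 13 * x + 8 := by linear_combination x ^ 2 * h5 + 5 * x * hx + 8 * hx
  fin_cases i <;> simp [oddCharacter, h3, h5, h7] <;> ring

lemma one_sub_phi_sq : (1 - phi) ^ 2 = (1 - phi) + 1 := by linear_combination phi_sq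

/-- Row orthogonality. Where φ survives, the traces ±φ and ±(1 - φ) contribute 24(φ² + (1 - φ)²) or
48φ(1 - φ), whence the multiples 48 of φ² = φ + 1. -/
lemma icoSum_evenCharacter (i j : Fin 5) :
    icoSum (evenCharacter i * evenCharacter j) = if i = j then 120 else 0 := by
  rw [icoSum, sum_icosians, ← neg_sub 1 phi]
  simp only [Pi.mul_apply, evenCharacter_neg, evenCharacter_two, evenCharacter_zero,
    evenCharacter_one, evenCharacter_of_sq phi_sq, evenCharacter_of_sq one_sub_phi_sq]
  fin_cases i <;> fin_cases j <;> simp <;>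
    first
    | ring1
    | linear_combination 48 * phi_sq
    | linear_combination -48 * phi_sq

lemma icoSum_oddCharacter (i j : Fin 4) :
    icoSum (oddCharacter i * oddCharacter j) = if i = j then 120 else 0 := by
  rw [icoSum, sum_icosians, ← neg_sub 1 phi]
  simp only [Pi.mul_apply, oddCharacter_neg, oddCharacter_two, oddCharacter_zero,
    oddCharacter_one, oddCharacter_of_sq phi_sq, oddCharacter_of_sq one_sub_phi_sq]
  fin_cases i <;> fin_cases j <;> simp <;>
    first
    | ring1
    | linear_combination 48 * phi_sq
    | linear_combination -48 * phi_sq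

/-- The part of the regular character of the icosians that is trivial on `-1`. -/
def evenRegular : ℂ → ℂ := ∑ i, (![1, 3, 5, 4, 3] i : ℤ) • evenCharacter i

/-- The part of the regular character of the icosians that is not trivial on `-1`. -/
def oddRegular : ℂ → ℂ := ∑ i, (![2, 4, 6, 2] i : ℤ) • oddCharacter i

lemma evenRegular_neg (t : ℂ) : evenRegular (-t) = evenRegular t := by
  simp [evenRegular, evenCharacter_neg]

lemma oddRegular_neg (t : ℂ) : oddRegular (-t) = -oddRegular t := by
  simp [oddRegular, oddCharacter_neg]

lemma evenRegular_two : evenRegular 2 = 60 := by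
  simp [evenRegular, evenCharacter_two, Fin.sum_univ_succ]
  norm_num

lemma oddRegular_two : oddRegular 2 = 60 := by
  simp [oddRegular, oddCharacter_two, Fin.sum_univ_succ]
  norm_num

/-- Each half of the regular character is supported on ±1; this is column orthogonality against the
columns of ±1. -/
lemma regular_eq_zero {t : ℂ} (ht : t ∈ ({0, 1, -1, phi, -phi, 1 - phi, phi - 1} : Set ℂ)) :
    evenRegular t = 0 ∧ oddRegular t = 0 := by
  have h0 : evenRegular 0 = 0 ∧ oddRegular 0 = 0 := by
    constructor
    · simp [evenRegular, evenCharacter_zero, Fin.sum_univ_succ]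
      norm_num
    · simp [oddRegular, oddCharacter_zero]
  have h1 : evenRegular 1 = 0 ∧ oddRegular 1 = 0 := by
    constructor
    · simp [evenRegular, evenCharacter_one, Fin.sum_univ_succ]
      norm_num
    · simp [oddRegular, oddCharacter_one, Fin.sum_univ_succ]
      norm_num
  have hx {x : ℂ} (hx : x ^ 2 = x + 1) : evenRegular x = 0 ∧ oddRegular x = 0 := by
    constructor
    · simp [evenRegular, evenCharacter_of_sq hx, Fin.sum_univ_succ]
      ring
    · simp [oddRegular, oddCharacter_of_sq hx, Fin.sum_univ_succ]
      ring
  have hneg {t : ℂ} (h : evenRegular t = 0 ∧ oddRegular t = 0) :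
      evenRegular (-t) = 0 ∧ oddRegular (-t) = 0 := by
    rwa [evenRegular_neg, oddRegular_neg, neg_eq_zero]
  obtain rfl | rfl | rfl | rfl | rfl | rfl | rfl := ht
  · exact h0
  · exact h1
  · exact hneg h1
  · exact hx phi_sq
  · exact hneg (hx phi_sq)
  · exact hx one_sub_phi_sq
  · exact neg_sub 1 phi ▸ hneg (hx one_sub_phi_sq)

end IcosianCharacters

/-! ### A criterion for a subring to be the whole representation ring -/

section Generation

variable {G : Type} [Group G] {L : icosians × icosians →* G} {C : G}

lemma IsInduced.sum {ι : Type} (s : Finset ι) {P : ι → ℂ → ℂ} {Q : ℂ → ℂ} {x : ι → RepRing G}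
    (hx : ∀ i ∈ s, IsInduced L C (P i) Q (x i)) :
    IsInduced L C (∑ i ∈ s, P i) Q (∑ i ∈ s, x i) := by
  classical
  induction s using Finset.induction_on with
  | empty => exact isInduced_zero Q
  | insert i s hi ih =>
    rw [Finset.sum_insert hi, Finset.sum_insert hi]
    exact (hx i (Finset.mem_insert_self i s)).add
      (ih fun j hj => hx j (Finset.mem_insert_of_mem hj))

lemma IsInduced.zsmul {P Q : ℂ → ℂ} {x : RepRing G} (hx : IsInduced L C P Q x) (n : ℤ) :
    IsInduced L C (n • P) Q (n • x) := fun p => by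
  simp only [zsmul_eq_mul, map_mul, map_intCast, Pi.mul_apply, Pi.intCast_apply, (hx p).1,
    (hx p).2]
  exact ⟨by ring, by ring⟩

lemma exists_isInduced_sum {ι : Type} [Fintype ι] [DecidableEq ι] {S : Set (RepRing G)}
    (P : ι → ℂ → ℂ) (d : ι → ℤ)
    (h : ∀ i j, ∃ x ∈ Submodule.span ℤ S, IsInduced L C (P i) (P j) x) :
    ∃ x ∈ Submodule.span ℤ S, IsInduced L C (∑ i, d i • P i) (∑ i, d i • P i) x := by
  have h1 (Q : ℂ → ℂ) (h : ∀ i, ∃ x ∈ Submodule.span ℤ S, IsInduced L C (P i) Q x) :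
      ∃ x ∈ Submodule.span ℤ S, IsInduced L C (∑ i, d i • P i) Q x := by
    choose x hx hx' using h
    exact ⟨∑ i, d i • x i, sum_mem fun i _ => zsmul_mem (hx i) _,
      IsInduced.sum _ fun i _ => (hx' i).zsmul _⟩
  refine h1 _ fun i => ?_
  obtain ⟨x, hx, hx'⟩ := h1 (P i) fun j => h j i
  exact ⟨x, hx, hx'.symm⟩

/-- A subring of the representation ring of the quotient by `(-1, -1)` of the wreath product of the
icosians with a group of order two is the whole ring as soon as it contains the sign of the wreath
product, the tensor square of the two-dimensional representation of the icosians, and the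
representation induced from a three-dimensional representation of the first factor. -/
theorem subring_eq_top_of_icosians [Finite G] (hC : C * C = 1) (hL : ∀ p, C * L p = L p.swap * C)
    (hsurj : ∀ g, ∃ p, g = L p ∨ g = L p * C)
    (hneg : L (⟨-1, neg_one_mem_icosians⟩, ⟨-1, neg_one_mem_icosians⟩) = 1)
    (A : Subring (RepRing G)) {e : RepRing G} (he : e ∈ A) (he' : IsTensorSquare L C (-1) 1 e)
    (hid : ∃ x ∈ A, IsTensorSquare L C 1 id x)
    (hind : ∃ x ∈ A, IsInduced L C (id ^ 2 - 1) 1 x) : A = ⊤ := by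
  let S : Set (RepRing G) := {x | x ∈ A ∧ RepRing.pairing x x = 1}
  have key {ι : Type} [DecidableEq ι] {s : ℕ} (P : ι → ℂ → ℂ) (hP : ∀ i, P i ∈ parityFunctions s)
      (hPP : ∀ i j, icoSum (P i * P j) = if i = j then 120 else 0) (i j : ι) :
      ∃ x ∈ Submodule.span ℤ S, IsInduced L C (P i) (P j) x := by
    have hone (i : ι) : icoSum (P i * P i) = 120 := by rw [hPP, if_pos rfl]
    -- For i = j the induced character is not of norm one, but it is the sum of two extensions that
    -- are.
    by_cases hij : i = j
    · subst hij
      obtain ⟨x, hx, hx'⟩ := exists_isTensorSquare A he he' hid hind (hP i)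
      have hex := he'.mul hx'
      rw [mul_one, one_mul] at hex
      refine ⟨x + e * x, add_mem (Submodule.subset_span ⟨hx, ?_⟩)
        (Submodule.subset_span ⟨mul_mem he hx, ?_⟩), isInduced_self hx' hex⟩
      · exact pairing_self_of_isTensorSquare hC hL hsurj (by norm_num) hx' (hone i)
      · exact pairing_self_of_isTensorSquare hC hL hsurj (by norm_num) hex (hone i)
    · obtain ⟨x, hx, hx'⟩ := exists_isInduced A he he' hid hind (hP i) (hP j)
      exact ⟨x, Submodule.subset_span ⟨hx, pairing_self_of_isInduced hC hL hsurj hx' (hone i)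
        (hone j) (by rw [hPP, if_neg hij])⟩, hx'⟩
  obtain ⟨x, hx, hx'⟩ := exists_isInduced_sum _ ![1, 3, 5, 4, 3]
    (key evenCharacter evenCharacter_mem icoSum_evenCharacter)
  obtain ⟨y, hy, hy'⟩ := exists_isInduced_sum _ ![2, 4, 6, 2]
    (key oddCharacter oddCharacter_mem icoSum_oddCharacter)
  -- At (1, -1) and (-1, 1) the even and odd parts cancel as 60² - 60²; they add up at (1, 1) and
  -- (-1, -1), both of which L sends to the identity.
  have hval (p : icosians × icosians) : RepRing.charHom G (x + y) (L p)
      = 2 * (evenRegular (redTrace p.1) * evenRegular (redTrace p.2)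
        + oddRegular (redTrace p.1) * oddRegular (redTrace p.2)) := by
    rw [map_add, Pi.add_apply, (hx' p).1, (hy' p).1]
    change evenRegular _ * evenRegular _ + evenRegular _ * evenRegular _
      + (oddRegular _ * oddRegular _ + oddRegular _ * oddRegular _) = _
    ring
  have hneg' {a : icosians} (ha : redTrace a = -2) : a = ⟨-1, neg_one_mem_icosians⟩ := by
    have h : -(a : unitary ℍ[ℂ]) ∈ icosians := by
      simpa using mul_mem neg_one_mem_icosians a.2
    refine Subtype.ext (neg_eq_iff_eq_neg.1 ((redTrace_eq_two_iff h).1 ?_))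
    rw [redTrace_neg, ha, neg_neg]
  have hpos {a : icosians} (ha : redTrace a = 2) : a = 1 :=
    Subtype.ext ((redTrace_eq_two_iff a.2).1 ha)
  refine RepRing.subring_eq_top A S (fun x hx => hx.1) (fun x hx => hx.2) (x + y) (add_mem hx hy)
    (fun g hg => ?_) ?_
  · obtain ⟨⟨a, b⟩, rfl | rfl⟩ := hsurj g
    · rw [hval]
      rcases redTrace_mem a.2 with ha | ha | ha
      · rcases redTrace_mem b.2 with hb | hb | hb
        · rw [hpos ha, hpos hb] at hg
          exact absurd (map_one L) hg
        · simp [ha, hb, evenRegular_neg, oddRegular_neg, evenRegular_two, oddRegular_two]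
        · simp [regular_eq_zero hb]
      · rcases redTrace_mem b.2 with hb | hb | hb
        · simp [ha, hb, evenRegular_neg, oddRegular_neg, evenRegular_two, oddRegular_two]
        · rw [hneg' ha, hneg' hb] at hg
          exact absurd hneg hg
        · simp [regular_eq_zero hb]
      · simp [regular_eq_zero ha]
    · rw [map_add, Pi.add_apply, (hx' _).2, (hy' _).2, add_zero]
  · have h1 : redTrace (1 : icosians) = 2 := (redTrace_eq_two_iff (one_mem _)).2 rfl
    have h := hval 1
    rw [map_one, Prod.fst_one, Prod.snd_one, h1, evenRegular_two, oddRegular_two] at h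
    rw [h]
    norm_num

end Generation

end

/-! ### The reflection group of type H₄ and its generating representations -/

noncomputable section

open Quaternion IcoCoord

section ReflectionGroup

variable {V : Type} [AddCommGroup V] [Module ℂ V] (b : Module.Basis (Fin 4) ℂ V)

/-- The subgroup of `GL(V)` generated by the simple reflections of type `H₄`. -/
abbrev icosianReflections : Subgroup (V ≃ₗ[ℂ] V) := reflectionSubgroup (rotHom b) (conjOn b)

/-- The rotation `x ↦ p x q` for icosians `p` and `q`. -/
def icoRot : icosians × icosians →* icosianReflections b :=
  ((rotHom b).comp (icosians.subtype.prodMap icosians.subtype)).codRestrict _ fun p =>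
    rot_mem_reflectionSubgroup (conjOn_mul_self b) (conjOn_mul_rotHom b) p.1.2 p.2.2

/-- Quaternion conjugation, as an element of the reflection group. -/
def icoConj : icosianReflections b :=
  ⟨conjOn b, conj_mem_reflectionSubgroup⟩

lemma icoConj_mul_self : icoConj b * icoConj b = 1 := Subtype.ext (conjOn_mul_self b)

lemma icoConj_mul_icoRot (p : icosians × icosians) :
    icoConj b * icoRot b p = icoRot b p.swap * icoConj b :=
  Subtype.ext (conjOn_mul_rotHom b p.1 p.2)

lemma exists_eq_icoRot (g : icosianReflections b) :
    ∃ p, g = icoRot b p ∨ g = icoRot b p * icoConj b := by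
  obtain ⟨x, hx, y, hy, h⟩ :=
    exists_of_mem_reflectionSubgroup (conjOn_mul_self b) (conjOn_mul_rotHom b) g.2
  exact ⟨(⟨x, hx⟩, ⟨y, hy⟩), h.imp (fun h => Subtype.ext h) fun h => Subtype.ext h⟩

lemma finite_icosianReflections : Finite (icosianReflections b) := by
  refine Finite.of_surjective (fun x : (icosians × icosians) ⊕ (icosians × icosians) =>
    x.elim (icoRot b) fun p => icoRot b p * icoConj b) fun g => ?_
  obtain ⟨p, rfl | rfl⟩ := exists_eq_icoRot b g
  · exact ⟨Sum.inl p, rfl⟩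
  · exact ⟨Sum.inr p, rfl⟩

/-- The determinant character of a subgroup of `GL(V)`. -/
def detRep (W : Subgroup (V ≃ₗ[ℂ] V)) : FDRep ℂ W :=
  FDRep.of (V := ℂ) ((Algebra.lmul ℂ ℂ).toMonoidHom.comp
    (LinearMap.det.comp (reflectionRep W)))

lemma finrank_detRep (W : Subgroup (V ≃ₗ[ℂ] V)) : Module.finrank ℂ (detRep W) = 1 :=
  Module.finrank_self ℂ

lemma character_detRep (W : Subgroup (V ≃ₗ[ℂ] V)) (g : W) :
    (detRep W).character g = LinearMap.det (g : V ≃ₗ[ℂ] V).toLinearMap := by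
  change LinearMap.trace ℂ ℂ (Algebra.lmul ℂ ℂ _) = _
  rw [LinearMap.trace_eq_matrix_trace ℂ (Module.Basis.singleton Unit ℂ)]
  simp [Matrix.trace, LinearMap.toMatrix_apply]
  rfl

lemma isTensorSquare_detRep :
    IsTensorSquare (icoRot b) (icoConj b) (-1) 1 (RepRing.mk (detRep (icosianReflections b))) :=
  fun p => by
    rw [RepRing.charHom_mk, character_detRep, character_detRep]
    have h1 : LinearMap.det ((icoRot b p : icosianReflections b) : V ≃ₗ[ℂ] V).toLinearMap = 1 :=
      det_rotHom b p.1 p.2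
    have h2 : LinearMap.det ((icoConj b : icosianReflections b) : V ≃ₗ[ℂ] V).toLinearMap = -1 :=
      det_conjOn b
    have h3 : ((icoRot b p * icoConj b : icosianReflections b) : V ≃ₗ[ℂ] V).toLinearMap
      = ((icoRot b p : icosianReflections b) : V ≃ₗ[ℂ] V).toLinearMap
        * ((icoConj b : icosianReflections b) : V ≃ₗ[ℂ] V).toLinearMap := rfl
    rw [h3, map_mul, h1, h2]
    simp

lemma trace_icoRot (p : icosians × icosians) :
    LinearMap.trace ℂ V (reflectionRep (icosianReflections b) (icoRot b p))
      = redTrace p.1 * redTrace p.2 :=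
  trace_rotHom b p.1 p.2

lemma trace_icoRot_mul_icoConj (p : icosians × icosians) :
    LinearMap.trace ℂ V (reflectionRep (icosianReflections b) (icoRot b p * icoConj b))
      = -redTrace ((p.1 : unitary ℍ[ℂ]) * p.2) :=
  trace_rotHom_mul_conjOn b p.1 p.2

lemma redTrace_mul_comm (x y : unitary ℍ[ℂ]) : redTrace (x * y) = redTrace (y * x) := by
  simp only [redTrace, Submonoid.coe_mul, re_mul]
  ring

variable [FiniteDimensional ℂ V]

lemma isTensorSquare_oneCell : IsTensorSquare (icoRot b) (icoConj b) (-1) id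
    (RepRing.mk (schurFunctor oneCell (reflectionRep (icosianReflections b)))) := fun p => by
  rw [RepRing.charHom_mk, character_oneCell, character_oneCell, trace_icoRot,
    trace_icoRot_mul_icoConj]
  simp

/-- Λ²V is the sum of self-dual and anti-self-dual bivectors, each a three-dimensional
representation of one factor, and C swaps them. On (a, b)C the character vanishes because the square
is the rotation (ab, ba), of trace t(ab)². -/
lemma isInduced_twoColumn : IsInduced (icoRot b) (icoConj b) (id ^ 2 - 1) 1
    (RepRing.mk (schurFunctor twoColumn (reflectionRep (icosianReflections b)))) := fun p => by
  have h : icoRot b p * icoConj b * (icoRot b p * icoConj b) = icoRot b (p * p.swap) := by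
    rw [mul_assoc, ← mul_assoc (icoConj b), icoConj_mul_icoRot, mul_assoc, icoConj_mul_self,
      mul_one, map_mul]
  rw [RepRing.charHom_mk, character_twoColumn, character_twoColumn, h, ← map_mul, trace_icoRot,
    trace_icoRot, trace_icoRot, trace_icoRot_mul_icoConj]
  simp only [Prod.fst_mul, Prod.snd_mul, Prod.fst_swap, Prod.snd_swap, Subgroup.coe_mul,
    redTrace_sq, redTrace_mul_comm (p.2 : unitary ℍ[ℂ]), Pi.sub_apply, Pi.pow_apply, Pi.one_apply,
    id]
  constructor <;> ring

end ReflectionGroup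

end

theorem mainTheorem11 {V : Type} [AddCommGroup V] [Module ℂ V] [FiniteDimensional ℂ V]
    (W : Subgroup (V ≃ₗ[ℂ] V)) (hW : IsReflectionGroupOfType CoxeterMatrix.H₄ W) :
    Subring.closure
      ({x : RepRing W | ∃ L : FDRep ℂ W, Module.finrank ℂ L = 1 ∧ x = RepRing.mk L} ∪
        {x : RepRing W | ∃ μ : YoungDiagram, μ.card ≤ 8 ∧
          x = RepRing.mk (schurFunctor μ (reflectionRep W))}) = ⊤ := by
  obtain ⟨b, hb⟩ := hW
  rw [closure_simpleReflection] at hb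
  subst hb
  have := finite_icosianReflections b
  have he := isTensorSquare_detRep b
  have hdet : RepRing.mk (detRep (icosianReflections b)) ∈ Subring.closure
      ({x : RepRing (icosianReflections b) |
          ∃ L : FDRep ℂ (icosianReflections b), Module.finrank ℂ L = 1 ∧ x = RepRing.mk L} ∪
        {x | ∃ μ : YoungDiagram, μ.card ≤ 8 ∧
          x = RepRing.mk (schurFunctor μ (reflectionRep (icosianReflections b)))}) :=
    Subring.subset_closure (Or.inl ⟨_, finrank_detRep _, rfl⟩)
  refine subring_eq_top_of_icosians (icoConj_mul_self b) (icoConj_mul_icoRot b)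
    (exists_eq_icoRot b) (Subtype.ext (rotHom_neg_one b)) _ hdet he
    -- V itself has trace -t(ab) on the nontrivial coset; tensoring with det corrects the sign.
    ⟨_, mul_mem hdet (Subring.subset_closure (Or.inr ⟨oneCell, by decide, rfl⟩)), ?_⟩
    ⟨_, Subring.subset_closure (Or.inr ⟨twoColumn, by decide, rfl⟩), isInduced_twoColumn b⟩
  have h := he.mul (isTensorSquare_oneCell b)
  rwa [one_mul, neg_mul_neg, one_mul] at h
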